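/- Let $2\le n\le N$. On $(0,\infty)$ put $u(t)=\frac{t-1}{t\log t}$ (with $u(1)=1$) and $v(t)=\int_0^t\tau u(\tau)^2\,d\tau$. For $X,Y\in\mathbb C^m$ write $\langle X,Y\rangle=\sum_i X_i\overline{Y_i}$, and let $$g(z,X)=\Big(1+\tfrac{v(|z|^2)}{|z|^2}\Big)|X|^2+\Big(u^2(|z|^2)-\tfrac{v(|z|^2)}{|z|^4}\Big)|\langle X,z\rangle|^2$$ be the Grauert metric on $\mathbb C^n\setminus\{0\}$. Let $\mathbb B^N\subset\mathbb C^N$ be the open unit ball, $\pi(z_1,\dots,z_N)=(z_1,\dots,z_n)$, $A=\{z\in\mathbb B^N: z_1=\dots=z_n=0\}$, and on $\mathbb B^N\setminus A$ let $$g_B=\pi^*g+\tilde g_B,\qquad \tilde g_B(z,X)=(N+1)\left(\frac{|\langle X,z\rangle|^2}{(1-|z|^2)^2}+\frac{|X|^2}{1-|z|^2}\right),$$ where $\tilde g_B$ is the Bergman metric of $\mathbb B^N$. Let $K^+_{g_B}(z)$ be the supremum of the holomorphic sectional curvatures of $g_B$ at $z$ over all nonzero tangent vectors (normalized so that in dimension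 one the curvature of $h|dT|^2$ is the Gaussian curvature $-2h^{-1}\partial\bar\partial\log h$). For $w\in A$ let $$D_w=\{z\in\mathbb B^N: z_j=w_j,\ n+1\le j\le N\}.$$ For $\alpha<0$ let $X(z)=z_1\frac{\partial}{\partial z_1}+\dots+z_{n-1}\frac{\partial}{\partial z_{n-1}}+\alpha z_n\frac{\partial}{\partial z_n}$, let $\mathcal K(z)$, $z\in\mathbb B^N\setminus A$, be the Gaussian curvature at $z$ of the restriction of $g_B$ to the leaf through $z$ of the holomorphic foliation induced by $X$, that is, the Gaussian curvature at $T=0$ of $Z^*g_B$ where $dZ/dT=X(Z)$, $Z(0)=z$, and let $$\mathcal S_w=\{z\in D_w\setminus A:\ \langle z,X(z)\rangle=0\}=\{z\in D_w\setminus A:\ |z_1|^2+\dots+|z_{n-1}|^2+\alpha|z_n|^2=0\}$$ be the locus in the slice where $X$ is orthogonal to the radial direction. **Theorem.** For every $w\in A$, $K^+_{g_B}(z)\to+\infty$ as $z\to w$ with $z\in D_w\setminus A$. Furthermore, for every $\alpha<0$, $\mathcal K(z)\to-\dfrac{6}{N+1}$ as $|z|\to1$ with $z\in\mathcal S_w$.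 -/

import Mathlib

open Filter Topology

noncomputable section

namespace Grauert

/-- The standard Hermitian inner product `⟨X, Y⟩ = ∑ X_i * conj Y_i`, linear in the first slot
(Mathlib's inner product is linear in the second slot). -/
def herm {m : ℕ} (X Y : EuclideanSpace ℂ (Fin m)) : ℂ := inner ℂ Y X

/-- `u(t) = (t - 1) / (t log t)` on `(0, ∞)`, with its real analytic value `1` at `t = 1`. -/
def u (t : ℝ) : ℝ := if t = 1 then 1 else (t - 1) / (t * Real.log t)

/-- `v(t) = ∫_0^t τ u(τ)^2 dτ`. -/
def v (t : ℝ) : ℝ := ∫ τ in (0 : ℝ)..t, τ * u τ ^ 2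

/-- A field of sesquilinear forms `g(z)(X, Y)` on `ℂ^m`, linear in `X`, conjugate linear in `Y`;
only its values on the domain of the metric matter. -/
abbrev FormField (m : ℕ) : Type :=
  EuclideanSpace ℂ (Fin m) → EuclideanSpace ℂ (Fin m) → EuclideanSpace ℂ (Fin m) → ℂ

/-- The Grauert metric on `ℂ^n \ {0}`:
`g(z)(X, Y) = (1 + v/|z|²) ⟨X, Y⟩ + (u² - v/|z|⁴) ⟨X, z⟩ ⟨z, Y⟩`, with `u, v` taken at `|z|²`. -/
def grauertMetric (n : ℕ) : FormField n := fun z X Y =>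
  ((1 + v (‖z‖ ^ 2) / ‖z‖ ^ 2 : ℝ) : ℂ) * herm X Y +
    ((u (‖z‖ ^ 2) ^ 2 - v (‖z‖ ^ 2) / ‖z‖ ^ 4 : ℝ) : ℂ) * (herm X z * herm z Y)

/-- The Bergman metric on the unit ball of `ℂ^N`. -/
def bergmanMetric (N : ℕ) : FormField N := fun z X Y =>
  ((N : ℂ) + 1) *
    (herm X z * herm z Y / (((1 - ‖z‖ ^ 2) ^ 2 : ℝ) : ℂ) + herm X Y / ((1 - ‖z‖ ^ 2 : ℝ) : ℂ))

/-- The projection `(z_1, …, z_N) ↦ (z_1, …, z_n)`. -/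
def proj {n N : ℕ} (h : n ≤ N) (z : EuclideanSpace ℂ (Fin N)) : EuclideanSpace ℂ (Fin n) :=
  WithLp.toLp 2 fun i => z (Fin.castLE h i)

/-- `g_B = π^* g +` Bergman metric, on `𝔹^N \ A` (`π` is linear, hence its own differential). -/
def gB {n N : ℕ} (h : n ≤ N) : FormField N := fun z X Y =>
  grauertMetric n (proj h z) (proj h X) (proj h Y) + bergmanMetric N z X Y

/-- `A = {z ∈ 𝔹^N : z_1 = ⋯ = z_n = 0}`. -/
def A {n N : ℕ} (h : n ≤ N) : Set (EuclideanSpace ℂ (Fin N)) :=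
  {z | z ∈ Metric.ball 0 1 ∧ proj h z = 0}

/-- The slice `D_w = {z ∈ 𝔹^N : z_j = w_j, n + 1 ≤ j ≤ N}` (the index `j : Fin N` is `j + 1` in
the one-based numbering). -/
def slice (n : ℕ) {N : ℕ} (w : EuclideanSpace ℂ (Fin N)) : Set (EuclideanSpace ℂ (Fin N)) :=
  {z | z ∈ Metric.ball 0 1 ∧ ∀ j : Fin N, n ≤ (j : ℕ) → z j = w j}

section Curvature

variable {E : Type*} [NormedAddCommGroup E] [NormedSpace ℂ E] [NormedSpace ℝ E]

/-- The Wirtinger derivative `∂_e f (z) = (1/2) (∂f/∂x - i ∂f/∂y)` in the complex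
direction `e`. -/
def dHol (f : E → ℂ) (e z : E) : ℂ :=
  (1 / 2) * (fderiv ℝ f z e - Complex.I * fderiv ℝ f z (Complex.I • e))

/-- The Wirtinger derivative `∂̄_e f (z) = (1/2) (∂f/∂x + i ∂f/∂y)` in the complex
direction `e`. -/
def dAnti (f : E → ℂ) (e z : E) : ℂ :=
  (1 / 2) * (fderiv ℝ f z e + Complex.I * fderiv ℝ f z (Complex.I • e))

end Curvature

/-- The components `g_{i j̄}(z) = g(z)(e_i, e_j)` of the metric. -/
def comps {m : ℕ} (g : FormField m) (z : EuclideanSpace ℂ (Fin m)) : Matrix (Fin m) (Fin m) ℂ :=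
  Matrix.of fun i j => g z (EuclideanSpace.single i 1) (EuclideanSpace.single j 1)

/-- The curvature tensor of a Kähler metric in coordinates,
`R_{i j̄ k l̄} = - ∂_k ∂̄_l g_{i j̄} + ∑_{p, q} g^{q̄ p} (∂_k g_{i q̄}) (∂̄_l g_{p j̄})`. -/
def curvTensor {m : ℕ} (g : FormField m) (z : EuclideanSpace ℂ (Fin m)) (i j k l : Fin m) : ℂ :=
  -dHol (fun y => dAnti (fun x => comps g x i j) (EuclideanSpace.single l 1) y)
      (EuclideanSpace.single k 1) z +
    ∑ p, ∑ q, (comps g z)⁻¹ q p *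
      dHol (fun x => comps g x i q) (EuclideanSpace.single k 1) z *
      dAnti (fun x => comps g x p j) (EuclideanSpace.single l 1) z

/-- The holomorphic sectional curvature `K_g(z, X) = 2 R(X, X̄, X, X̄) / g(z, X)²` of `g` at `z`
along `X ≠ 0`. The factor `2` makes it, for `m = 1`, the Gaussian curvature of `g = h |dT|²`. -/
def holSecCurv {m : ℕ} (g : FormField m) (z X : EuclideanSpace ℂ (Fin m)) : ℝ :=
  2 * (∑ i, ∑ j, ∑ k, ∑ l,
      curvTensor g z i j k l * X i * starRingEnd ℂ (X j) * X k * starRingEnd ℂ (X l)).re /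
    (g z X X).re ^ 2

/-- `K⁺_g(z)`: the supremum of the holomorphic sectional curvatures at `z`. -/
def Kplus {m : ℕ} (g : FormField m) (z : EuclideanSpace ℂ (Fin m)) : EReal :=
  ⨆ (X : EuclideanSpace ℂ (Fin m)) (_ : X ≠ 0), ((holSecCurv g z X : ℝ) : EReal)

/-- The Gaussian curvature `-2 h⁻¹ ∂∂̄ log h` (that is, `-(Δ log h) / (2 h)`) of the conformal
metric `h |dT|²` at the point `T` of the plane. -/
def gaussCurv (h : ℂ → ℝ) (T : ℂ) : ℝ :=
  -2 / h T * (dHol (fun S => dAnti (fun R => ((Real.log (h R) : ℝ) : ℂ)) 1 S) 1 T).re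

/-- The density `h` of the pull-back `φ^* g = h |dT|²` of `g` by a holomorphic curve `φ`. -/
def pullback {m : ℕ} (g : FormField m) (φ : ℂ → EuclideanSpace ℂ (Fin m)) (T : ℂ) : ℝ :=
  (g (φ T) (deriv φ T) (deriv φ T)).re

/-- The coefficients `(1, …, 1, α, 0, …, 0)` of the saddle vector field, `α` in the `n`-th place. -/
def saddleCoeff (n : ℕ) {N : ℕ} (α : ℝ) (i : Fin N) : ℂ :=
  if (i : ℕ) + 1 < n then 1 else if (i : ℕ) + 1 = n then (α : ℂ) else 0

/-- The saddle vector field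
`X(z) = z_1 ∂/∂z_1 + ⋯ + z_{n-1} ∂/∂z_{n-1} + α z_n ∂/∂z_n` on `ℂ^N`. -/
def saddleField (n : ℕ) {N : ℕ} (α : ℝ) (z : EuclideanSpace ℂ (Fin N)) :
    EuclideanSpace ℂ (Fin N) :=
  WithLp.toLp 2 fun i => saddleCoeff n α i * z i

/-- The parametrization `T ↦ Z(T)` of the leaf through `z`: the solution of `dZ/dT = X(Z)`,
`Z(0) = z` (see the two lemmas below). -/
def saddleFlow (n : ℕ) {N : ℕ} (α : ℝ) (z : EuclideanSpace ℂ (Fin N)) (T : ℂ) :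
    EuclideanSpace ℂ (Fin N) :=
  WithLp.toLp 2 fun i => Complex.exp (saddleCoeff n α i * T) * z i

theorem saddleFlow_zero (n : ℕ) {N : ℕ} (α : ℝ) (z : EuclideanSpace ℂ (Fin N)) :
    saddleFlow n α z 0 = z := by
  ext i
  simp [saddleFlow]

theorem hasDerivAt_saddleFlow (n : ℕ) {N : ℕ} (α : ℝ) (z : EuclideanSpace ℂ (Fin N)) (T : ℂ) :
    HasDerivAt (saddleFlow n α z) (saddleField n α (saddleFlow n α z T)) T := by
  have h : HasDerivAt (fun S : ℂ => fun i : Fin N => Complex.exp (saddleCoeff n α i * S) * z i)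
      (fun i => saddleCoeff n α i * saddleFlow n α z T i) T := by
    rw [hasDerivAt_pi]
    intro i
    have h := (((hasDerivAt_id T).const_mul (saddleCoeff n α i)).cexp).mul_const (z i)
    refine h.congr_deriv ?_
    simp only [saddleFlow, id, mul_one]
    ring
  exact (PiLp.hasFDerivAt_toLp (𝕜 := ℂ) 2 _).comp_hasDerivAt T h

/-- The leafwise curvature `𝒦(z)`: the Gaussian curvature at `z` of the restriction of `g_B` to
the leaf of the saddle foliation through `z`. -/
def leafCurv {n N : ℕ} (h : n ≤ N) (α : ℝ) (z : EuclideanSpace ℂ (Fin N)) : ℝ :=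
  gaussCurv (pullback (gB h) (saddleFlow n α z)) 0

/-- `𝒮_w`: the points of `D_w \ A` at which the saddle vector field is orthogonal to the radial
direction. -/
def orthoLocus {n N : ℕ} (h : n ≤ N) (α : ℝ) (w : EuclideanSpace ℂ (Fin N)) :
    Set (EuclideanSpace ℂ (Fin N)) :=
  {z | z ∈ slice n w \ A h ∧ herm z (saddleField n α z) = 0}

end Grauert

end

open scoped ContDiff

noncomputable section

namespace Grauert

/-! Both summands of `gB` have radial Kähler potentials, φ(|πz|²) and ψ(|z|²). Write t = |πz|² and s
= |z|²; then `grauertCoeff`, `grauertCoeff'` are φ', φ'' and `bergmanCoeff`, `bergmanCoeff'` are ψ',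
ψ''. Both claims reduce to explicit curvature formulas in these four functions.

Blow-up: since n ≥ 2, there is X ≠ 0 in the first n coordinates with ⟨X, z⟩ = 0. At z the
holomorphic derivatives of g(X, e_q) along X vanish, so only the second derivative of g(X, X)
survives. On the line z + S X this is a function of |S|², and the curvature is -4(φ'' + ψ'')/(φ' +
ψ')² (`holSecCurv_tangential`). With L = -log t, the primitive -1/log τ of 1/(τ log² τ) gives v ~
1/L as t → 0. Hence φ' ~ 1/(tL) and φ'' ~ -1/(t²L), while the ψ terms stay bounded, so the curvature
grows like 4L (`tendsto_tangential_curvature` proves the bound L/16).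

Leaves: along the flow, t and the Hermitian products of X and z are exponential sums in Re T, so the
density depends on Re T only. On the orthogonality locus the first derivative of t vanishes, and the
curvature becomes -6(φ'' + ψ'')/(φ' + ψ')² - 2/((φ' + ψ') t) (`leafCurv_of_mem_orthoLocus`),
independent of α. As s → 1 in a slice, t tends to 1 - |w|² > 0, so the Grauert terms stay bounded
while ψ' = (N+1)/(1-s) and ψ'' = (N+1)/(1-s)² dominate; the limit is -6/(N+1). -/

/-! ### Regularity of u and v, and two-sided bounds for v near 0. -/

theorem continuousAt_u {t : ℝ} (ht : 0 < t) : ContinuousAt u t := by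
  by_cases h1 : t = 1
  · subst h1
    have h : Tendsto (fun t : ℝ => (t * (Real.log t / (t - 1)))⁻¹) (𝓝[≠] 1) (𝓝 1) := by
      have h0 : Tendsto (slope Real.log 1) (𝓝[≠] 1) (𝓝 1) := by
        simpa using (hasDerivAt_iff_tendsto_slope.1 (Real.hasDerivAt_log one_ne_zero))
      have h2 : Tendsto (fun t : ℝ => t) (𝓝[≠] 1) (𝓝 1) := tendsto_id.mono_left nhdsWithin_le_nhds
      have h3 := (h2.mul h0).inv₀ (by norm_num)
      simp only [mul_one, inv_one] at h3
      refine h3.congr' ?_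
      filter_upwards with t
      rw [slope_def_field, Real.log_one, sub_zero]
    rw [continuousAt_iff_punctured_nhds]
    have h4 : u 1 = 1 := by simp [u]
    rw [h4]
    refine h.congr' ?_
    filter_upwards [self_mem_nhdsWithin] with t ht1
    have : t ≠ 1 := ht1
    simp only [u, if_neg this]
    rw [mul_div_assoc', inv_div]
  · have h : ContinuousAt (fun t : ℝ => (t - 1) / (t * Real.log t)) t := by
      refine ContinuousAt.div (by fun_prop) ?_ ?_
      · exact continuousAt_id.mul (Real.continuousAt_log ht.ne')
      · exact mul_ne_zero ht.ne' (Real.log_ne_zero_of_pos_of_ne_one ht h1)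
    refine h.congr ?_
    filter_upwards [isOpen_ne.mem_nhds h1] with x hx
    simp [u, if_neg hx]

theorem contDiffAt_u {t : ℝ} (ht : 0 < t) (h1 : t ≠ 1) {k : WithTop ℕ∞} : ContDiffAt ℝ k u t := by
  have h : ContDiffAt ℝ k (fun t : ℝ => (t - 1) / (t * Real.log t)) t := by
    refine ContDiffAt.div (by fun_prop) ?_ ?_
    · exact contDiffAt_id.mul (Real.contDiffAt_log.2 ht.ne')
    · exact mul_ne_zero ht.ne' (Real.log_ne_zero_of_pos_of_ne_one ht h1)
  refine h.congr_of_eventuallyEq ?_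
  filter_upwards [isOpen_ne.mem_nhds h1] with x hx
  simp [u, if_neg hx]

theorem mul_u_sq {t : ℝ} (ht : 0 < t) (h1 : t ≠ 1) :
    t * u t ^ 2 = (1 - t) ^ 2 * (t⁻¹ / Real.log t ^ 2) := by
  have := Real.log_ne_zero_of_pos_of_ne_one ht h1
  simp only [u, if_neg h1]
  field_simp
  ring

theorem continuousOn_neg_inv_log : ContinuousOn (fun t : ℝ => -(Real.log t)⁻¹) (Set.Ico 0 1) := by
  intro t ht
  rcases ht.1.eq_or_lt with h0 | h0
  · subst h0
    refine ContinuousAt.continuousWithinAt ?_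
    rw [continuousAt_iff_punctured_nhds]
    -- With `Real.log 0 = 0` the function takes the value 0 at 0, which is its limit there.
    have h := tendsto_inv_atBot_zero.comp (Real.tendsto_log_nhdsNE_zero)
    simpa using h.neg
  · refine ContinuousAt.continuousWithinAt ?_
    exact ((Real.continuousAt_log h0.ne').inv₀
      (Real.log_ne_zero_of_pos_of_ne_one h0 ht.2.ne)).neg

theorem hasDerivAt_neg_inv_log {t : ℝ} (ht : 0 < t) (h1 : t ≠ 1) :
    HasDerivAt (fun t : ℝ => -(Real.log t)⁻¹) (t⁻¹ / Real.log t ^ 2) t := by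
  have := ((Real.hasDerivAt_log ht.ne').inv (Real.log_ne_zero_of_pos_of_ne_one ht h1)).neg
  refine this.congr_deriv ?_
  ring

/-- The integrand is the nonnegative derivative of a function continuous up to the endpoint 0, and
this forces integrability despite the singularity. -/
theorem intervalIntegrable_inv_div_log_sq {t : ℝ} (ht : 0 < t) (h1 : t < 1) :
    IntervalIntegrable (fun τ : ℝ => τ⁻¹ / Real.log τ ^ 2) MeasureTheory.volume 0 t := by
  rw [intervalIntegrable_iff_integrableOn_Ioc_of_le ht.le]
  refine intervalIntegral.integrableOn_deriv_of_nonneg (g := fun t : ℝ => -(Real.log t)⁻¹) ?_ ?_ ?_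
  · exact continuousOn_neg_inv_log.mono fun x hx => ⟨hx.1, hx.2.trans_lt h1⟩
  · intro x hx
    exact hasDerivAt_neg_inv_log hx.1 (hx.2.trans h1).ne
  · intro x hx
    have := hx.1
    positivity

theorem integral_inv_div_log_sq {t : ℝ} (ht : 0 < t) (h1 : t < 1) :
    ∫ τ in (0 : ℝ)..t, τ⁻¹ / Real.log τ ^ 2 = (-Real.log t)⁻¹ := by
  rw [intervalIntegral.integral_eq_sub_of_hasDerivAt_of_le ht.le
    (f := fun t : ℝ => -(Real.log t)⁻¹) ?_ ?_ (intervalIntegrable_inv_div_log_sq ht h1)]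
  · simp [inv_neg]
  · exact continuousOn_neg_inv_log.mono fun x hx => ⟨hx.1, hx.2.trans_lt h1⟩
  · intro x hx
    exact hasDerivAt_neg_inv_log hx.1 (hx.2.trans h1).ne

theorem continuousOn_mul_u_sq : ContinuousOn (fun τ : ℝ => τ * u τ ^ 2) (Set.Ioi 0) :=
  fun _ ht => (continuousAt_id.mul ((continuousAt_u ht).pow 2)).continuousWithinAt

theorem intervalIntegrable_mul_u_sq_of_lt_one {t : ℝ} (ht : 0 < t) (h1 : t < 1) :
    IntervalIntegrable (fun τ : ℝ => τ * u τ ^ 2) MeasureTheory.volume 0 t := by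
  have h := (intervalIntegrable_inv_div_log_sq ht h1)
  have h2 := h.continuousOn_mul (g := fun τ : ℝ => (1 - τ) ^ 2) (by fun_prop)
  refine h2.congr ?_
  intro x hx
  rw [Set.uIoc_of_le ht.le] at hx
  exact (mul_u_sq hx.1 (hx.2.trans_lt h1).ne).symm

theorem intervalIntegrable_mul_u_sq {t : ℝ} (ht : 0 < t) :
    IntervalIntegrable (fun τ : ℝ => τ * u τ ^ 2) MeasureTheory.volume 0 t := by
  -- The singularity at 0 is handled on [0, 1/2]; from 1/2 to t the integrand is continuous, also
  -- across 1.
  refine (intervalIntegrable_mul_u_sq_of_lt_one (t := 1 / 2) (by norm_num) (by norm_num)).trans ?_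
  refine (continuousOn_mul_u_sq.mono ?_).intervalIntegrable
  intro x hx
  exact lt_of_lt_of_le (lt_min (by norm_num) ht) hx.1

theorem hasDerivAt_v {t : ℝ} (ht : 0 < t) : HasDerivAt v (t * u t ^ 2) t :=
  intervalIntegral.integral_hasDerivAt_right (intervalIntegrable_mul_u_sq ht)
    (continuousOn_mul_u_sq.stronglyMeasurableAtFilter isOpen_Ioi t ht)
    (continuousOn_mul_u_sq.continuousAt (Ioi_mem_nhds ht))

theorem contDiffAt_v {t : ℝ} (ht : 0 < t) (h1 : t ≠ 1) : ContDiffAt ℝ ∞ v t := by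
  have ho : IsOpen (Set.Ioi (0 : ℝ) ∩ {1}ᶜ) := isOpen_Ioi.inter isOpen_compl_singleton
  have h : ContDiffOn ℝ ∞ v (Set.Ioi (0 : ℝ) ∩ {1}ᶜ) := by
    rw [contDiffOn_infty_iff_deriv_of_isOpen ho]
    refine ⟨fun x hx => (hasDerivAt_v hx.1).differentiableAt.differentiableWithinAt, ?_⟩
    refine ContDiffOn.congr (f := fun τ => τ * u τ ^ 2) ?_ fun x hx => (hasDerivAt_v hx.1).deriv
    intro x hx
    exact (contDiffAt_id.mul ((contDiffAt_u hx.1 hx.2).pow 2)).contDiffWithinAt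
  exact h.contDiffAt (ho.mem_nhds ⟨ht, h1⟩)

/-- The integrand of v is (1 - τ)² times that of 1/(-log t), and (1 - τ)² lies between (1 - t)² and
1 on (0, t); this gives the upper bound here and the lower bound in `le_v`. -/
theorem v_le {t : ℝ} (ht : 0 < t) (h1 : t < 1) : v t ≤ (-Real.log t)⁻¹ := by
  rw [← integral_inv_div_log_sq ht h1]
  refine intervalIntegral.integral_mono_on_of_le_Ioo ht.le
    (intervalIntegrable_mul_u_sq ht) (intervalIntegrable_inv_div_log_sq ht h1) ?_
  intro x hx
  have hx0 := hx.1
  have hx1 := hx.2.trans h1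
  rw [mul_u_sq hx0 hx1.ne]
  refine mul_le_of_le_one_left (by positivity) ?_
  nlinarith

theorem le_v {t : ℝ} (ht : 0 < t) (h1 : t < 1) : (1 - t) ^ 2 * (-Real.log t)⁻¹ ≤ v t := by
  rw [← integral_inv_div_log_sq ht h1, ← intervalIntegral.integral_const_mul]
  refine intervalIntegral.integral_mono_on_of_le_Ioo ht.le
    ((intervalIntegrable_inv_div_log_sq ht h1).const_mul _) (intervalIntegrable_mul_u_sq ht) ?_
  intro x hx
  have hx0 := hx.1
  rw [mul_u_sq hx0 (hx.2.trans h1).ne]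
  have := hx.2
  gcongr

/-! ### Coefficients of the two radial potentials, and the tangential curvature as t → 0. -/

/-- The coefficient `φ'(t)` of the Grauert metric with Kähler potential `φ(|z|²)`. -/
def grauertCoeff (t : ℝ) : ℝ := 1 + v t / t

/-- The coefficient `φ''(t)` of the Grauert metric with Kähler potential `φ(|z|²)`. -/
def grauertCoeff' (t : ℝ) : ℝ := u t ^ 2 - v t / t ^ 2

/-- The coefficient `ψ'(s)` of the Bergman metric with Kähler potential
`ψ(|z|²) = -(N + 1) log (1 - |z|²)`. -/
def bergmanCoeff (N : ℕ) (s : ℝ) : ℝ := ((N : ℝ) + 1) / (1 - s)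

/-- The coefficient `ψ''(s)` of the Bergman metric. -/
def bergmanCoeff' (N : ℕ) (s : ℝ) : ℝ := ((N : ℝ) + 1) / (1 - s) ^ 2

theorem hasDerivAt_grauertCoeff {t : ℝ} (ht : 0 < t) :
    HasDerivAt grauertCoeff (grauertCoeff' t) t := by
  have h := ((hasDerivAt_v ht).div (hasDerivAt_id t) ht.ne').const_add 1
  refine h.congr_deriv ?_
  simp only [grauertCoeff', id]
  field_simp

theorem hasDerivAt_bergmanCoeff (N : ℕ) {s : ℝ} (hs : s < 1) :
    HasDerivAt (bergmanCoeff N) (bergmanCoeff' N s) s := by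
  have hs' : 1 - s ≠ 0 := by linarith
  have h := (((hasDerivAt_id s).const_sub 1).inv hs').const_mul ((N : ℝ) + 1)
  refine (h.congr_deriv ?_)
  simp only [bergmanCoeff', id]
  field_simp

theorem contDiffAt_grauertCoeff {t : ℝ} (ht : 0 < t) (h1 : t ≠ 1) :
    ContDiffAt ℝ ∞ grauertCoeff t :=
  contDiffAt_const.add ((contDiffAt_v ht h1).div contDiffAt_id ht.ne')

theorem contDiffAt_grauertCoeff' {t : ℝ} (ht : 0 < t) (h1 : t ≠ 1) :
    ContDiffAt ℝ ∞ grauertCoeff' t :=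
  ((contDiffAt_u ht h1).pow 2).sub
    ((contDiffAt_v ht h1).div (contDiffAt_id.pow 2) (pow_ne_zero 2 ht.ne'))

theorem contDiffAt_bergmanCoeff (N : ℕ) {s : ℝ} (hs : s < 1) :
    ContDiffAt ℝ ∞ (bergmanCoeff N) s :=
  contDiffAt_const.div (contDiffAt_const.sub contDiffAt_id) (by simp; linarith)

theorem contDiffAt_bergmanCoeff' (N : ℕ) {s : ℝ} (hs : s < 1) :
    ContDiffAt ℝ ∞ (bergmanCoeff' N) s :=
  contDiffAt_const.div ((contDiffAt_const.sub contDiffAt_id).pow 2)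
    (pow_ne_zero 2 (by simp; linarith))

theorem continuousAt_grauertCoeff {t : ℝ} (ht : 0 < t) : ContinuousAt grauertCoeff t :=
  (hasDerivAt_grauertCoeff ht).continuousAt

theorem continuousAt_grauertCoeff' {t : ℝ} (ht : 0 < t) : ContinuousAt grauertCoeff' t :=
  ((continuousAt_u ht).pow 2).sub
    ((hasDerivAt_v ht).continuousAt.div (continuousAt_id.pow 2) (pow_ne_zero 2 ht.ne'))

theorem one_le_grauertCoeff {t : ℝ} (ht : 0 < t) : 1 ≤ grauertCoeff t := by
  have : 0 ≤ v t := by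
    refine intervalIntegral.integral_nonneg ht.le fun x hx => ?_
    have := hx.1
    positivity
  have : 0 ≤ v t / t := by positivity
  simp only [grauertCoeff]
  linarith

theorem bergmanCoeff_pos (N : ℕ) {s : ℝ} (hs : s < 1) : 0 < bergmanCoeff N s :=
  div_pos (by positivity) (by linarith)

/-- The tangential curvature `-4 (φ'' + ψ'') / (φ' + ψ')²` is unbounded near the origin. -/
theorem tendsto_tangential_curvature {ι : Type*} {l : Filter ι} {t p q : ι → ℝ}
    (ht : Tendsto t l (𝓝[>] 0)) {p₀ q₀ : ℝ} (hp : Tendsto p l (𝓝 p₀)) (hq : Tendsto q l (𝓝 q₀))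
    (hp0 : ∀ᶠ x in l, 0 < p x) :
    Tendsto (fun x => -4 * (grauertCoeff' (t x) + q x) / (grauertCoeff (t x) + p x) ^ 2)
      l atTop := by
  have hL : Tendsto (fun x => -Real.log (t x)) l atTop :=
    tendsto_neg_atBot_atTop.comp (Real.tendsto_log_nhdsGT_zero.comp ht)
  have htL : Tendsto (fun x => t x * -Real.log (t x)) l (𝓝 0) := by
    have := (tendsto_log_mul_rpow_nhdsGT_zero one_pos).comp ht
    simpa [Function.comp_def, mul_comm] using this.neg
  have ht0 : Tendsto t l (𝓝 0) := ht.mono_right nhdsWithin_le_nhds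
  -- Smallness conditions that absorb the bounded Bergman terms p and q; together with t < 1/2 and L
  -- ≥ 8 they yield the constants below.
  have e1 : ∀ᶠ x in l, (1 + p x) * (t x * -Real.log (t x)) < 1 := by
    have := (hp.const_add 1).mul htL
    rw [mul_zero] at this
    exact this.eventually_lt_const one_pos
  have e2 : ∀ᶠ x in l, q x * (t x * (t x * -Real.log (t x))) < 1 / 16 := by
    have := hq.mul (ht0.mul htL)
    simp only [mul_zero] at this
    exact this.eventually_lt_const (by norm_num)
  have e3 : ∀ᶠ x in l, t x < 1 / 2 := ht0.eventually_lt_const (by norm_num)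
  have e4 : ∀ᶠ x in l, 0 < t x := ht.eventually self_mem_nhdsWithin
  refine tendsto_atTop_mono' l ?_ (hL.atTop_div_const (show (0 : ℝ) < 16 by norm_num))
  filter_upwards [e1, e2, e3, e4, hL.eventually_ge_atTop 8, hp0] with x h1 h2 h3 h4 h5 h6
  have hvl := le_v h4 (by linarith)
  have hvu := v_le h4 (by linarith)
  have hu := mul_u_sq h4 (by linarith)
  have hlog : Real.log (t x) ^ 2 = (-Real.log (t x)) ^ 2 := by ring
  rw [hlog] at hu
  have hA := one_le_grauertCoeff h4
  have hA' : grauertCoeff (t x) = 1 + v (t x) / t x := rfl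
  have hB' : grauertCoeff' (t x) = u (t x) ^ 2 - v (t x) / t x ^ 2 := rfl
  generalize -Real.log (t x) = L at *
  generalize t x = t at *
  generalize p x = p at *
  generalize q x = q at *
  have hL0 : 0 < L := by linarith
  have hvl' : 1 / 4 ≤ L * v t := by
    have : (1 - t) ^ 2 ≤ L * v t := by
      have := mul_le_mul_of_nonneg_left hvl hL0.le
      field_simp at this
      linarith
    nlinarith
  have hvu' : L * v t ≤ 1 := by
    have := mul_le_mul_of_nonneg_left hvu hL0.le
    field_simp at this
    linarith
  -- The left side equals (1 + p) t L + L v, and each summand is at most 1.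
  have hden : (grauertCoeff t + p) * (L * t) ≤ 2 := by
    rw [hA']
    field_simp
    nlinarith
  have hu' : t ^ 2 * L ^ 2 * u t ^ 2 = (1 - t) ^ 2 := by
    field_simp at hu
    linarith
  -- The three terms are bounded by L v ≥ 1/4, t² L u² = (1 - t)²/L ≤ 1/8 and q t² L < 1/16, and 1/4
  -- - 1/8 - 1/16 = 1/16.
  have hnum : 1 / 16 ≤ -(grauertCoeff' t + q) * (L * t ^ 2) := by
    have h7 : t ^ 2 * L * u t ^ 2 ≤ 1 / 8 := by
      have h8 : 8 * (t ^ 2 * L * u t ^ 2) ≤ L * (t ^ 2 * L * u t ^ 2) := by gcongr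
      nlinarith
    have h9 : -(grauertCoeff' t + q) * (L * t ^ 2)
        = L * v t - t ^ 2 * L * u t ^ 2 - q * (t * (t * L)) := by
      rw [hB']
      field_simp
      ring
    rw [h9]
    linarith
  have hpos : 0 < grauertCoeff t + p := by linarith
  rw [le_div_iff₀ (by positivity)]
  have hsq : ((grauertCoeff t + p) * (L * t)) ^ 2 ≤ 4 := by
    have : 0 ≤ (grauertCoeff t + p) * (L * t) := by positivity
    nlinarith
  have hLt : 0 < L * t ^ 2 := by positivity
  refine le_of_mul_le_mul_right ?_ hLt
  calc L / 16 * (grauertCoeff t + p) ^ 2 * (L * t ^ 2)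
      = ((grauertCoeff t + p) * (L * t)) ^ 2 / 16 := by ring
    _ ≤ -4 * (grauertCoeff' t + q) * (L * t ^ 2) := by linarith

/-! ### Wirtinger calculus. -/

theorem eventually_differentiableAt {E : Type*} [NormedAddCommGroup E] [NormedSpace ℝ E]
    {f : E → ℂ} {z : E} (h : ContDiffAt ℝ 2 f z) :
    ∀ᶠ y in 𝓝 z, DifferentiableAt ℝ f y :=
  (h.eventually (by simp)).mono fun _ hy => hy.differentiableAt two_ne_zero

section Wirtinger

variable {E : Type*} [NormedAddCommGroup E] [NormedSpace ℂ E] [NormedSpace ℝ E]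

theorem dHol_of_hasFDerivAt {f : E → ℂ} {L : E →L[ℝ] ℂ} {z : E} (h : HasFDerivAt f L z) (e : E) :
    dHol f e z = (1 / 2) * (L e - Complex.I * L (Complex.I • e)) := by
  rw [Grauert.dHol, h.fderiv]

theorem dAnti_of_hasFDerivAt {f : E → ℂ} {L : E →L[ℝ] ℂ} {z : E} (h : HasFDerivAt f L z) (e : E) :
    dAnti f e z = (1 / 2) * (L e + Complex.I * L (Complex.I • e)) := by
  rw [Grauert.dAnti, h.fderiv]

theorem dHol_congr {f g : E → ℂ} {z : E} (h : f =ᶠ[𝓝 z] g) (e : E) : dHol f e z = dHol g e z := by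
  rw [dHol, dHol, h.fderiv_eq]

theorem dHol_sum {ι : Type*} [Fintype ι] {F : ι → E → ℂ} {z : E} (c : ι → ℂ)
    (h : ∀ i, DifferentiableAt ℝ (F i) z) (e : E) :
    dHol (fun x => ∑ i, c i * F i x) e z = ∑ i, c i * dHol (F i) e z := by
  have h1 : HasFDerivAt (fun x => ∑ i, c i * F i x) (∑ i, c i • fderiv ℝ (F i) z) z :=
    HasFDerivAt.fun_sum fun i _ => (h i).hasFDerivAt.const_mul (c i)
  rw [dHol_of_hasFDerivAt h1]
  simp only [sum_apply, FunLike.coe_smul, Pi.smul_apply, smul_eq_mul, dHol,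
    Finset.mul_sum, ← Finset.sum_sub_distrib]
  exact Finset.sum_congr rfl fun i _ => by ring

theorem dAnti_sum {ι : Type*} [Fintype ι] {F : ι → E → ℂ} {z : E} (c : ι → ℂ)
    (h : ∀ i, DifferentiableAt ℝ (F i) z) (e : E) :
    dAnti (fun x => ∑ i, c i * F i x) e z = ∑ i, c i * dAnti (F i) e z := by
  have h1 : HasFDerivAt (fun x => ∑ i, c i * F i x) (∑ i, c i • fderiv ℝ (F i) z) z :=
    HasFDerivAt.fun_sum fun i _ => (h i).hasFDerivAt.const_mul (c i)
  rw [dAnti_of_hasFDerivAt h1]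
  simp only [sum_apply, FunLike.coe_smul, Pi.smul_apply, smul_eq_mul, dAnti,
    Finset.mul_sum, ← Finset.sum_add_distrib]
  exact Finset.sum_congr rfl fun i _ => by ring

theorem differentiableAt_dAnti {f : E → ℂ} {z : E} (h : ContDiffAt ℝ 2 f z) (e : E) :
    DifferentiableAt ℝ (fun y => dAnti f e y) z := by
  have h1 : DifferentiableAt ℝ (fderiv ℝ f) z :=
    (h.fderiv_right (m := 1) (by norm_num [one_add_one_eq_two])).differentiableAt one_ne_zero
  unfold dAnti
  fun_prop

variable [IsScalarTower ℝ ℂ E]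

theorem smul_eq_re_add_im (c : ℂ) (e : E) : c • e = c.re • e + c.im • (Complex.I • e) := by
  conv_lhs => rw [← Complex.re_add_im c]
  have h : ∀ (r : ℝ) (x : E), (r : ℂ) • x = r • x := fun r x => algebraMap_smul ℂ r x
  rw [add_smul, mul_smul, h, h]

/-- Complex linearity in the direction, with its conjugate analogue `dAnti_smul`, lets coordinate
derivatives be assembled into derivatives along X. -/
theorem dHol_smul (f : E → ℂ) (c : ℂ) (e z : E) : dHol f (c • e) z = c * dHol f e z := by
  have h1 : Complex.I • (c • e) = c.re • (Complex.I • e) - c.im • e := by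
    rw [smul_smul, mul_comm, mul_smul, smul_eq_re_add_im c, smul_smul Complex.I, Complex.I_mul_I]
    simp [sub_eq_add_neg]
  rw [dHol, dHol, h1, smul_eq_re_add_im c e]
  simp only [map_add, map_sub, map_smul, Complex.real_smul]
  conv_rhs => rw [← Complex.re_add_im c]
  linear_combination (1 / 2 * (c.im : ℂ) * fderiv ℝ f z (Complex.I • e)) * Complex.I_sq

theorem dAnti_smul (f : E → ℂ) (c : ℂ) (e z : E) :
    dAnti f (c • e) z = starRingEnd ℂ c * dAnti f e z := by
  have h1 : Complex.I • (c • e) = c.re • (Complex.I • e) - c.im • e := by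
    rw [smul_smul, mul_comm, mul_smul, smul_eq_re_add_im c, smul_smul Complex.I, Complex.I_mul_I]
    simp [sub_eq_add_neg]
  have h2 : starRingEnd ℂ c = c.re - c.im * Complex.I := by
    apply Complex.ext <;> simp
  rw [dAnti, dAnti, h1, smul_eq_re_add_im c e, h2]
  simp only [map_add, map_sub, map_smul, Complex.real_smul]
  linear_combination (1 / 2 * (c.im : ℂ) * fderiv ℝ f z (Complex.I • e)) * Complex.I_sq

theorem dHol_sum_dir {ι : Type*} [Fintype ι] (f : E → ℂ) (c : ι → ℂ) (e : ι → E) (z : E) :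
    dHol f (∑ i, c i • e i) z = ∑ i, c i * dHol f (e i) z := by
  have h : dHol f (∑ i, c i • e i) z = ∑ i, dHol f (c i • e i) z := by
    simp only [dHol, Finset.smul_sum, map_sum, Finset.mul_sum, ← Finset.sum_sub_distrib]
  rw [h]
  exact Finset.sum_congr rfl fun i _ => dHol_smul _ _ _ _

theorem dAnti_sum_dir {ι : Type*} [Fintype ι] (f : E → ℂ) (c : ι → ℂ) (e : ι → E) (z : E) :
    dAnti f (∑ i, c i • e i) z = ∑ i, starRingEnd ℂ (c i) * dAnti f (e i) z := by
  have h : dAnti f (∑ i, c i • e i) z = ∑ i, dAnti f (c i • e i) z := by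
    simp only [dAnti, Finset.smul_sum, map_sum, Finset.mul_sum, ← Finset.sum_add_distrib]
  rw [h]
  exact Finset.sum_congr rfl fun i _ => dAnti_smul _ _ _ _

theorem hasFDerivAt_line (z e : E) (S : ℂ) :
    HasFDerivAt (fun R : ℂ => z + R • e)
      ((ContinuousLinearMap.toSpanSingleton ℂ e).restrictScalars ℝ) S := by
  have h := ((ContinuousLinearMap.toSpanSingleton ℂ e).restrictScalars ℝ).hasFDerivAt (x := S)
  exact h.const_add z

theorem dHol_line {f : E → ℂ} {z e : E} {S : ℂ} (h : DifferentiableAt ℝ f (z + S • e)) :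
    dHol (fun R : ℂ => f (z + R • e)) 1 S = dHol f e (z + S • e) := by
  refine (dHol_of_hasFDerivAt (h.hasFDerivAt.comp S (hasFDerivAt_line z e S)) 1).trans ?_
  simp [dHol]

theorem dAnti_line {f : E → ℂ} {z e : E} {S : ℂ} (h : DifferentiableAt ℝ f (z + S • e)) :
    dAnti (fun R : ℂ => f (z + R • e)) 1 S = dAnti f e (z + S • e) := by
  refine (dAnti_of_hasFDerivAt (h.hasFDerivAt.comp S (hasFDerivAt_line z e S)) 1).trans ?_
  simp [dAnti]

theorem tendsto_line (z e : E) : Tendsto (fun S : ℂ => z + S • e) (𝓝 0) (𝓝 z) := by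
  have h := (hasFDerivAt_line z e 0).continuousAt
  rw [ContinuousAt, zero_smul, add_zero] at h
  exact h

/-- The mixed second Wirtinger derivative in one direction is computed on a complex line. -/
theorem dHol_dAnti_eq_line {f : E → ℂ} {z : E} (h : ContDiffAt ℝ 2 f z) (e : E) :
    dHol (fun y => dAnti f e y) e z =
      dHol (fun S : ℂ => dAnti (fun R : ℂ => f (z + R • e)) 1 S) 1 0 := by
  have h1 : (fun S : ℂ => dAnti (fun R : ℂ => f (z + R • e)) 1 S) =ᶠ[𝓝 0]
      fun S => dAnti f e (z + S • e) :=
    ((tendsto_line z e).eventually (eventually_differentiableAt h)).mono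
      fun S hS => dAnti_line hS
  have h0 : z + (0 : ℂ) • e = z := by simp
  rw [dHol_congr h1, dHol_line (f := fun y => dAnti f e y) (z := z) (e := e) (S := 0)
    (by rw [h0]; exact differentiableAt_dAnti h e), h0]

end Wirtinger

/-! ### One-variable derivatives: functions of |S|² and functions of Re T. -/

theorem hasFDerivAt_norm_sq (S : ℂ) :
    HasFDerivAt (fun R : ℂ => ‖R‖ ^ 2) (2 • (innerSL ℝ S)) S :=
  (hasStrictFDerivAt_norm_sq S).hasFDerivAt

theorem hasFDerivAt_radial {ρ : ℝ → ℝ} {ρ' : ℝ} {S : ℂ} (h : HasDerivAt ρ ρ' (‖S‖ ^ 2)) :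
    HasFDerivAt (fun R : ℂ => ((ρ (‖R‖ ^ 2) : ℝ) : ℂ))
      (Complex.ofRealCLM.comp (ρ' • (2 • innerSL ℝ S))) S :=
  Complex.ofRealCLM.hasFDerivAt.comp S (h.comp_hasFDerivAt S (hasFDerivAt_norm_sq S))

/-- Near 0 the antiholomorphic derivative is ρ'(|S|²) S, and at S = 0 only the factor S needs to be
differentiated. -/
theorem dHol_dAnti_radial {ρ : ℝ → ℝ} (h : ContDiffAt ℝ 2 ρ 0) :
    dHol (fun S : ℂ => dAnti (fun R : ℂ => ((ρ (‖R‖ ^ 2) : ℝ) : ℂ)) 1 S) 1 0 = deriv ρ 0 := by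
  have ht : Tendsto (fun S : ℂ => ‖S‖ ^ 2) (𝓝 0) (𝓝 0) := by
    have : Continuous fun S : ℂ => ‖S‖ ^ 2 := by fun_prop
    simpa using this.tendsto 0
  have h1 : (fun S : ℂ => dAnti (fun R : ℂ => ((ρ (‖R‖ ^ 2) : ℝ) : ℂ)) 1 S) =ᶠ[𝓝 0]
      fun S => ((deriv ρ (‖S‖ ^ 2) : ℝ) : ℂ) * S := by
    refine (ht.eventually ((h.eventually (by simp)))).mono fun S hS => ?_
    have hd := (hS.differentiableAt two_ne_zero).hasDerivAt
    simp only
    rw [dAnti_of_hasFDerivAt (hasFDerivAt_radial hd)]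
    apply Complex.ext <;> simp [Complex.inner] <;> ring
  have hd : HasDerivAt (deriv ρ) (deriv (deriv ρ) 0) (‖(0 : ℂ)‖ ^ 2) := by
    have h3 : DifferentiableAt ℝ (fderiv ℝ ρ) 0 :=
      (h.fderiv_right (m := 1) (by norm_num [one_add_one_eq_two])).differentiableAt one_ne_zero
    have h4 : DifferentiableAt ℝ (deriv ρ) 0 := h3.clm_apply (differentiableAt_const (1 : ℝ))
    simpa using h4.hasDerivAt
  have h2 := (hasFDerivAt_radial hd).mul (hasFDerivAt_id (𝕜 := ℝ) (0 : ℂ))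
  rw [dHol_congr h1]
  refine (dHol_of_hasFDerivAt h2 1).trans ?_
  simp
  linear_combination (-1 / 2 * ((deriv ρ 0 : ℝ) : ℂ)) * Complex.I_sq

/-- `k₁(|S|²) c₁ + ∑_{i = 2, 3} k_i(|S|²) S̄ (d_i + c_i S)` has vanishing holomorphic derivative at
the origin. -/
theorem dHol_radial_conj {k₁ k₂ k₃ : ℝ → ℝ} (h₁ : DifferentiableAt ℝ k₁ 0)
    (h₂ : DifferentiableAt ℝ k₂ 0) (h₃ : DifferentiableAt ℝ k₃ 0) (c₁ d₂ c₂ d₃ c₃ : ℂ) :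
    dHol (fun S : ℂ => ((k₁ (‖S‖ ^ 2) : ℝ) : ℂ) * c₁ +
      ((k₂ (‖S‖ ^ 2) : ℝ) : ℂ) * (starRingEnd ℂ S * (d₂ + S * c₂)) +
      ((k₃ (‖S‖ ^ 2) : ℝ) : ℂ) * (starRingEnd ℂ S * (d₃ + S * c₃))) 1 0 = 0 := by
  -- Each radial factor is critical at 0, and conj S vanishes there with zero holomorphic
  -- derivative, so every term of the product rule drops out.
  have e {k : ℝ → ℝ} (h : DifferentiableAt ℝ k 0) :
      HasDerivAt k (deriv k 0) (‖(0 : ℂ)‖ ^ 2) := by simpa using h.hasDerivAt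
  have e3 : HasFDerivAt (fun S : ℂ => starRingEnd ℂ S) (Complex.conjCLE : ℂ →L[ℝ] ℂ) 0 :=
    Complex.conjCLE.hasFDerivAt
  have e4 (c d : ℂ) := ((hasFDerivAt_id (𝕜 := ℝ) (0 : ℂ)).mul_const c).const_add d
  have h := (((hasFDerivAt_radial (e h₁)).mul_const c₁).add
    ((hasFDerivAt_radial (e h₂)).mul (e3.mul (e4 c₂ d₂)))).add
    ((hasFDerivAt_radial (e h₃)).mul (e3.mul (e4 c₃ d₃)))
  refine (dHol_of_hasFDerivAt h 1).trans ?_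
  simp
  linear_combination (((k₂ 0 : ℝ) : ℂ) * d₂ + ((k₃ 0 : ℝ) : ℂ) * d₃) * Complex.I_sq

theorem hasFDerivAt_comp_re {η : ℝ → ℝ} {η' : ℝ} {S : ℂ} (h : HasDerivAt η η' S.re) :
    HasFDerivAt (fun R : ℂ => ((η R.re : ℝ) : ℂ))
      (Complex.ofRealCLM.comp (η' • Complex.reCLM)) S :=
  Complex.ofRealCLM.hasFDerivAt.comp S (h.comp_hasFDerivAt S Complex.reCLM.hasFDerivAt)

/-- The Gaussian curvature of a metric whose density depends on the real part only. -/
theorem gaussCurv_comp_re {η η' : ℝ → ℝ} {η'' : ℝ} (h : ∀ᶠ x in 𝓝 0, HasDerivAt η (η' x) x)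
    (h' : HasDerivAt η' η'' 0) (h0 : η 0 ≠ 0) :
    gaussCurv (fun T => η T.re) 0 =
      -(1 / 2) / η 0 * (η'' / η 0 - (η' 0 / η 0) ^ 2) := by
  have ht : Tendsto Complex.re (𝓝 0) (𝓝 0) := by
    simpa using Complex.continuous_re.tendsto 0
  have hne : ∀ᶠ x in 𝓝 0, η x ≠ 0 := h.self_of_nhds.continuousAt.eventually_ne h0
  -- On functions of Re T both Wirtinger derivatives are half of d/dx, so ∂∂̄ log η is a quarter of
  -- (log η)''.
  have h1 : (fun S : ℂ => dAnti (fun R : ℂ => ((Real.log (η R.re) : ℝ) : ℂ)) 1 S) =ᶠ[𝓝 0]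
      fun S => ((1 / 2 * (η' S.re / η S.re) : ℝ) : ℂ) := by
    refine (ht.eventually (h.and hne)).mono fun S hS => ?_
    simp only
    rw [dAnti_of_hasFDerivAt (hasFDerivAt_comp_re (hS.1.log hS.2))]
    simp
  have h2 : HasDerivAt (fun x => 1 / 2 * (η' x / η x))
      (1 / 2 * ((η'' * η 0 - η' 0 * η' 0) / η 0 ^ 2)) 0 :=
    (h'.div h.self_of_nhds h0).const_mul _
  rw [gaussCurv, dHol_congr h1, dHol_of_hasFDerivAt (hasFDerivAt_comp_re (S := 0) h2)]
  simp only [ContinuousLinearMap.comp_apply, FunLike.coe_smul, Pi.smul_apply, smul_eq_mul,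
    Complex.reCLM_apply, Complex.ofRealCLM_apply, Complex.one_re, Complex.I_re, mul_one, mul_zero,
    Complex.ofReal_zero, sub_zero, Complex.zero_re]
  rw [show (1 / 2 : ℂ) = ((1 / 2 : ℝ) : ℂ) by push_cast; rfl, Complex.re_ofReal_mul,
    Complex.ofReal_re]
  field_simp

/-! ### Contraction of the curvature tensor along one vector. -/

theorem sum_comm_four {ι κ : Type*} [Fintype ι] [Fintype κ] (F : ι → ι → ι → ι → κ → ℂ) :
    ∑ i, ∑ j, ∑ k, ∑ l, ∑ p, F i j k l p = ∑ p, ∑ i, ∑ j, ∑ k, ∑ l, F i j k l p := by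
  symm
  rw [Finset.sum_comm]
  refine Finset.sum_congr rfl fun i _ => ?_
  rw [Finset.sum_comm]
  refine Finset.sum_congr rfl fun j _ => ?_
  rw [Finset.sum_comm]
  exact Finset.sum_congr rfl fun k _ => Finset.sum_comm

/-- The full contraction of the curvature tensor along one vector. -/
theorem sum_curvTensor {m : ℕ} {g : FormField m} {z : EuclideanSpace ℂ (Fin m)}
    (hg : ∀ i j, ContDiffAt ℝ 2 (fun x => comps g x i j) z) (X : EuclideanSpace ℂ (Fin m)) :
    ∑ i, ∑ j, ∑ k, ∑ l,
      curvTensor g z i j k l * X i * starRingEnd ℂ (X j) * X k * starRingEnd ℂ (X l) =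
    -dHol (fun y => dAnti
        (fun x => ∑ i, X i * ∑ j, starRingEnd ℂ (X j) * comps g x i j) X y) X z +
      ∑ p, ∑ q, (comps g z)⁻¹ q p *
        dHol (fun x => ∑ i, X i * comps g x i q) X z *
        dAnti (fun x => ∑ j, starRingEnd ℂ (X j) * comps g x p j) X z := by
  have hX : X = ∑ i, X i • (EuclideanSpace.single i 1 : EuclideanSpace ℂ (Fin m)) := by
    ext j
    simp [Pi.single_apply]
  have hd : ∀ i j, DifferentiableAt ℝ (fun x => comps g x i j) z :=
    fun i j => (hg i j).differentiableAt two_ne_zero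
  have hsum : ∀ (f : EuclideanSpace ℂ (Fin m) → ℂ) y,
      dHol f X y = ∑ k, X k * dHol f (EuclideanSpace.single k 1) y := by
    intro f y
    conv_lhs => rw [hX]
    exact dHol_sum_dir _ _ _ _
  have hsum' : ∀ (f : EuclideanSpace ℂ (Fin m) → ℂ) y,
      dAnti f X y = ∑ k, starRingEnd ℂ (X k) * dAnti f (EuclideanSpace.single k 1) y := by
    intro f y
    conv_lhs => rw [hX]
    exact dAnti_sum_dir _ _ _ _
  -- The identity is needed on a neighbourhood of z because it is differentiated once more.
  have hev : (fun y => dAnti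
        (fun x => ∑ i, X i * ∑ j, starRingEnd ℂ (X j) * comps g x i j) X y) =ᶠ[𝓝 z]
      fun y => ∑ i, X i * ∑ j, starRingEnd ℂ (X j) * ∑ l, starRingEnd ℂ (X l) *
        dAnti (fun x => comps g x i j) (EuclideanSpace.single l 1) y := by
    have : ∀ᶠ y in 𝓝 z, ∀ i j, DifferentiableAt ℝ (fun x => comps g x i j) y := by
      simp only [eventually_all]
      exact fun i j => eventually_differentiableAt (hg i j)
    refine this.mono fun y hy => ?_
    simp only
    rw [dAnti_sum _ fun i => by fun_prop]
    refine Finset.sum_congr rfl fun i _ => ?_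
    rw [dAnti_sum _ fun j => hy i j]
    simp only [hsum']
  have hD : ∀ i j l, DifferentiableAt ℝ
      (fun y => dAnti (fun x => comps g x i j) (EuclideanSpace.single l 1) y) z :=
    fun i j l => differentiableAt_dAnti (hg i j) _
  rw [dHol_congr hev, dHol_sum _ fun i => by fun_prop]
  have hfirst : ∀ i, dHol (fun y => ∑ j, starRingEnd ℂ (X j) * ∑ l, starRingEnd ℂ (X l) *
        dAnti (fun x => comps g x i j) (EuclideanSpace.single l 1) y) X z =
      ∑ j, starRingEnd ℂ (X j) * ∑ l, starRingEnd ℂ (X l) * ∑ k, X k *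
        dHol (fun y => dAnti (fun x => comps g x i j) (EuclideanSpace.single l 1) y)
          (EuclideanSpace.single k 1) z := by
    intro i
    rw [dHol_sum _ fun j => by fun_prop]
    refine Finset.sum_congr rfl fun j _ => ?_
    rw [dHol_sum _ fun l => hD i j l]
    simp only [hsum]
  have hH : ∀ q, dHol (fun x => ∑ i, X i * comps g x i q) X z =
      ∑ i, X i * ∑ k, X k * dHol (fun x => comps g x i q) (EuclideanSpace.single k 1) z := by
    intro q
    rw [dHol_sum _ fun i => hd i q]
    simp only [hsum]
  have hA : ∀ p, dAnti (fun x => ∑ j, starRingEnd ℂ (X j) * comps g x p j) X z =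
      ∑ j, starRingEnd ℂ (X j) * ∑ l, starRingEnd ℂ (X l) *
        dAnti (fun x => comps g x p j) (EuclideanSpace.single l 1) z := by
    intro p
    rw [dAnti_sum _ fun j => hd p j]
    simp only [hsum']
  simp only [hfirst, hH, hA, curvTensor, add_mul, Finset.sum_add_distrib]
  congr 1
  · rw [← Finset.sum_neg_distrib]
    refine Finset.sum_congr rfl fun i _ => ?_
    rw [Finset.mul_sum, ← Finset.sum_neg_distrib]
    refine Finset.sum_congr rfl fun j _ => ?_
    simp only [Finset.mul_sum, ← Finset.sum_neg_distrib]
    rw [Finset.sum_comm]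
    exact Finset.sum_congr rfl fun l _ => Finset.sum_congr rfl fun k _ => by ring
  -- For fixed p and q the fourfold sum factors into a sum over i, k times a sum over j, l.
  · simp only [Finset.sum_mul]
    rw [sum_comm_four]
    refine Finset.sum_congr rfl fun p _ => ?_
    rw [sum_comm_four]
    refine Finset.sum_congr rfl fun q _ => ?_
    rw [mul_assoc, Finset.sum_mul_sum, Finset.mul_sum]
    refine Finset.sum_congr rfl fun i _ => ?_
    rw [Finset.mul_sum]
    refine Finset.sum_congr rfl fun j _ => ?_
    rw [mul_mul_mul_comm, Finset.sum_mul_sum, Finset.mul_sum, Finset.mul_sum]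
    refine Finset.sum_congr rfl fun k _ => ?_
    rw [Finset.mul_sum, Finset.mul_sum]
    exact Finset.sum_congr rfl fun l _ => by ring

theorem two_le_infty : (2 : WithTop ℕ∞) ≤ ∞ := WithTop.coe_le_coe.2 (le_top : (2 : ℕ∞) ≤ ⊤)

/-! ### Hermitian algebra, the projection, and slices. -/

section Herm

variable {m : ℕ}

theorem herm_apply (X Y : EuclideanSpace ℂ (Fin m)) :
    herm X Y = ∑ i, X i * starRingEnd ℂ (Y i) := by
  simp [herm, PiLp.inner_apply]

theorem herm_add_left (X Y Z : EuclideanSpace ℂ (Fin m)) :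
    herm (X + Y) Z = herm X Z + herm Y Z := inner_add_right _ _ _

theorem herm_smul_left (c : ℂ) (X Z : EuclideanSpace ℂ (Fin m)) :
    herm (c • X) Z = c * herm X Z := inner_smul_right _ _ _

theorem herm_add_right (X Y Z : EuclideanSpace ℂ (Fin m)) :
    herm X (Y + Z) = herm X Y + herm X Z := inner_add_left _ _ _

theorem herm_smul_right (c : ℂ) (X Z : EuclideanSpace ℂ (Fin m)) :
    herm X (c • Z) = starRingEnd ℂ c * herm X Z := inner_smul_left _ _ _

theorem conj_herm (X Y : EuclideanSpace ℂ (Fin m)) : starRingEnd ℂ (herm X Y) = herm Y X :=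
  inner_conj_symm _ _

theorem herm_self (X : EuclideanSpace ℂ (Fin m)) : herm X X = ((‖X‖ ^ 2 : ℝ) : ℂ) := by
  simp [herm, inner_self_eq_norm_sq_to_K]

theorem norm_add_smul_sq {X z : EuclideanSpace ℂ (Fin m)} (h : herm X z = 0) (S : ℂ) :
    ‖z + S • X‖ ^ 2 = ‖z‖ ^ 2 + ‖S‖ ^ 2 * ‖X‖ ^ 2 := by
  have h' : herm z X = 0 := by rw [← conj_herm, h, map_zero]
  have h1 := herm_self (z + S • X)
  rw [herm_add_left, herm_add_right, herm_add_right, herm_smul_left, herm_smul_left,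
    herm_smul_right, herm_smul_right, h, h', herm_self, herm_self] at h1
  have h2 : S * starRingEnd ℂ S = ((‖S‖ ^ 2 : ℝ) : ℂ) := by
    rw [Complex.mul_conj, Complex.normSq_eq_norm_sq]
  rw [← Complex.ofReal_inj, ← h1]
  push_cast at h2 ⊢
  linear_combination ((‖X‖ : ℂ) ^ 2) * h2

theorem contDiff_herm_left (X : EuclideanSpace ℂ (Fin m)) {k : WithTop ℕ∞} :
    ContDiff ℝ k fun x => herm x X :=
  ((innerSL ℂ X).restrictScalars ℝ).contDiff

theorem contDiff_herm_right (X : EuclideanSpace ℂ (Fin m)) {k : WithTop ℕ∞} :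
    ContDiff ℝ k fun x => herm X x := by
  have h : (fun x => herm X x) = fun x => Complex.conjCLE (herm x X) := by
    funext x
    simp [conj_herm]
  rw [h]
  exact Complex.conjCLE.contDiff.comp (contDiff_herm_left X)

end Herm

section Proj

variable {n N : ℕ} (h : n ≤ N)

theorem proj_add (X Y : EuclideanSpace ℂ (Fin N)) : proj h (X + Y) = proj h X + proj h Y := rfl

theorem proj_smul (c : ℂ) (X : EuclideanSpace ℂ (Fin N)) : proj h (c • X) = c • proj h X := rfl

/-- The projection as a continuous linear map. -/
def projCLM : EuclideanSpace ℂ (Fin N) →L[ℂ] EuclideanSpace ℂ (Fin n) :=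
  LinearMap.toContinuousLinearMap
    { toFun := proj h, map_add' := proj_add h, map_smul' := proj_smul h }

theorem contDiff_proj {k : WithTop ℕ∞} : ContDiff ℝ k (proj h) :=
  ((projCLM h).restrictScalars ℝ).contDiff

theorem sum_castLE {M : Type*} [AddCommMonoid M] (f : Fin N → M)
    (hf : ∀ j : Fin N, n ≤ (j : ℕ) → f j = 0) : ∑ i, f (Fin.castLE h i) = ∑ j, f j := by
  refine Finset.sum_of_injOn (Fin.castLE h) (Fin.castLE_injective h).injOn (by simp) ?_
    fun _ _ => rfl
  intro j _ hj
  refine hf j (not_lt.1 fun hlt => hj ⟨⟨j, hlt⟩, by simp, rfl⟩)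

theorem herm_proj {X : EuclideanSpace ℂ (Fin N)} (hX : ∀ j : Fin N, n ≤ (j : ℕ) → X j = 0)
    (Y : EuclideanSpace ℂ (Fin N)) : herm (proj h X) (proj h Y) = herm X Y := by
  rw [herm_apply, herm_apply]
  exact sum_castLE h (fun j => X j * starRingEnd ℂ (Y j)) fun j hj => by simp [hX j hj]

theorem norm_proj {X : EuclideanSpace ℂ (Fin N)} (hX : ∀ j : Fin N, n ≤ (j : ℕ) → X j = 0) :
    ‖proj h X‖ ^ 2 = ‖X‖ ^ 2 := by
  have := herm_proj h hX X
  rwa [herm_self, herm_self, Complex.ofReal_inj] at this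

/-- Pythagoras: z - w lives in the first n coordinates and w in the remaining ones. -/
theorem norm_proj_add_slice {z w : EuclideanSpace ℂ (Fin N)}
    (hw : proj h w = 0) (hz : ∀ j : Fin N, n ≤ (j : ℕ) → z j = w j) :
    ‖z‖ ^ 2 = ‖proj h z‖ ^ 2 + ‖w‖ ^ 2 := by
  have hX : ∀ j : Fin N, n ≤ (j : ℕ) → (z - w) j = 0 := fun j hj => by simp [hz j hj]
  have h1 : proj h (z - w) = proj h z := by
    rw [sub_eq_add_neg, proj_add, ← neg_one_smul ℂ w, proj_smul, hw]
    simp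
  have h0 : herm (z - w) w = 0 := by
    rw [← herm_proj h hX, hw, herm, inner_zero_left]
  have h2 := norm_add_smul_sq h0 1
  rw [one_smul, add_sub_cancel, norm_one, ← norm_proj h hX, h1] at h2
  linarith

end Proj

/-! ### The metric `gB`, its tangential curvature, and the blow-up along A. -/

section Metric

variable {n N : ℕ} (h : n ≤ N)

theorem gB_apply (x X Y : EuclideanSpace ℂ (Fin N)) :
    gB h x X Y = (grauertCoeff (‖proj h x‖ ^ 2) : ℂ) * herm (proj h X) (proj h Y) +
      (grauertCoeff' (‖proj h x‖ ^ 2) : ℂ) *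
        (herm (proj h X) (proj h x) * herm (proj h x) (proj h Y)) +
      (bergmanCoeff N (‖x‖ ^ 2) : ℂ) * herm X Y +
      (bergmanCoeff' N (‖x‖ ^ 2) : ℂ) * (herm X x * herm x Y) := by
  simp only [gB, grauertMetric, bergmanMetric, grauertCoeff, grauertCoeff', bergmanCoeff,
    bergmanCoeff']
  push_cast
  ring

theorem isLinearMap_gB (x Y : EuclideanSpace ℂ (Fin N)) :
    IsLinearMap ℂ fun X => gB h x X Y where
  map_add X X' := by
    simp only [gB_apply, proj_add, herm_add_left]
    ring
  map_smul c X := by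
    simp only [gB_apply, proj_smul, herm_smul_left, smul_eq_mul]
    ring

theorem conj_gB (x X Y : EuclideanSpace ℂ (Fin N)) :
    starRingEnd ℂ (gB h x X Y) = gB h x Y X := by
  simp only [gB_apply, map_add, map_mul, conj_herm, Complex.conj_ofReal]
  ring

theorem sum_gB_left (x X Y : EuclideanSpace ℂ (Fin N)) :
    ∑ i, X i * gB h x (EuclideanSpace.single i 1) Y = gB h x X Y := by
  have hX : X = ∑ i, X i • (EuclideanSpace.single i 1 : EuclideanSpace ℂ (Fin N)) := by
    ext j
    simp [Pi.single_apply]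
  have h1 := map_sum ((isLinearMap_gB h x Y).mk' _)
    (fun i => X i • (EuclideanSpace.single i 1 : EuclideanSpace ℂ (Fin N))) Finset.univ
  rw [← hX] at h1
  refine Eq.trans ?_ h1.symm
  refine Finset.sum_congr rfl fun i _ => ?_
  rw [map_smul, smul_eq_mul, IsLinearMap.mk'_apply]

theorem sum_gB_right (x X Y : EuclideanSpace ℂ (Fin N)) :
    ∑ j, starRingEnd ℂ (Y j) * gB h x X (EuclideanSpace.single j 1) = gB h x X Y := by
  rw [← conj_gB h x Y X, ← sum_gB_left h x Y X, map_sum]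
  simp only [map_mul, conj_gB]

theorem contDiffAt_gB {z : EuclideanSpace ℂ (Fin N)} (h0 : 0 < ‖proj h z‖ ^ 2)
    (h1 : ‖proj h z‖ ^ 2 < 1) (hz : ‖z‖ ^ 2 < 1) (X Y : EuclideanSpace ℂ (Fin N)) :
    ContDiffAt ℝ 2 (fun x => gB h x X Y) z := by
  have hp : ContDiffAt ℝ ∞ (proj h) z := (contDiff_proj h).contDiffAt
  have ht : ContDiffAt ℝ ∞ (fun x => ‖proj h x‖ ^ 2) z := hp.norm_sq ℂ
  have hs : ContDiffAt ℝ ∞ (fun x : EuclideanSpace ℂ (Fin N) => ‖x‖ ^ 2) z :=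
    (contDiff_norm_sq ℂ).contDiffAt
  have hC {f : EuclideanSpace ℂ (Fin N) → ℝ} (hf : ContDiffAt ℝ ∞ f z) :
      ContDiffAt ℝ ∞ (fun x => (f x : ℂ)) z := Complex.ofRealCLM.contDiff.contDiffAt.comp z hf
  have ha := hC ((contDiffAt_grauertCoeff h0 h1.ne).comp z ht)
  have hb := hC ((contDiffAt_grauertCoeff' h0 h1.ne).comp z ht)
  have hc := hC ((contDiffAt_bergmanCoeff N hz).comp z hs)
  have hd := hC ((contDiffAt_bergmanCoeff' N hz).comp z hs)
  have e1 : ContDiffAt ℝ ∞ (fun x => herm (proj h X) (proj h x)) z :=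
    (contDiff_herm_right _).contDiffAt.comp z hp
  have e2 : ContDiffAt ℝ ∞ (fun x => herm (proj h x) (proj h Y)) z :=
    (contDiff_herm_left (proj h Y)).contDiffAt.comp z hp
  have e3 : ContDiffAt ℝ ∞ (fun x => herm X x) z := (contDiff_herm_right X).contDiffAt
  have e4 : ContDiffAt ℝ ∞ (fun x => herm x Y) z := (contDiff_herm_left Y).contDiffAt
  simp only [gB_apply]
  refine ContDiffAt.of_le (n := ∞) ?_ two_le_infty
  exact (((ha.mul contDiffAt_const).add (hb.mul (e1.mul e2))).add
    (hc.mul contDiffAt_const)).add (hd.mul (e3.mul e4))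

/-- Orthogonality makes both |z + S X|² and |π(z + S X)|² affine in |S|², so everything restricted
to the complex line through z along X is governed by radial functions of S. -/
theorem holSecCurv_tangential {z X : EuclideanSpace ℂ (Fin N)} (h0 : 0 < ‖proj h z‖ ^ 2)
    (h1 : ‖proj h z‖ ^ 2 < 1) (hz : ‖z‖ ^ 2 < 1) (hX : ∀ j : Fin N, n ≤ (j : ℕ) → X j = 0)
    (hX0 : X ≠ 0) (hXz : herm X z = 0) :
    holSecCurv (gB h) z X =
      -4 * (grauertCoeff' (‖proj h z‖ ^ 2) + bergmanCoeff' N (‖z‖ ^ 2)) /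
        (grauertCoeff (‖proj h z‖ ^ 2) + bergmanCoeff N (‖z‖ ^ 2)) ^ 2 := by
  have hr : 0 < ‖X‖ ^ 2 := by positivity
  have hXz' : herm (proj h X) (proj h z) = 0 := by rw [herm_proj h hX, hXz]
  have hns : ∀ S : ℂ, ‖z + S • X‖ ^ 2 = ‖z‖ ^ 2 + ‖S‖ ^ 2 * ‖X‖ ^ 2 := norm_add_smul_sq hXz
  have hnt : ∀ S : ℂ, ‖proj h (z + S • X)‖ ^ 2 = ‖proj h z‖ ^ 2 + ‖S‖ ^ 2 * ‖X‖ ^ 2 := by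
    intro S
    rw [proj_add, proj_smul, norm_add_smul_sq hXz', norm_proj h hX]
  have hXx : ∀ S : ℂ, herm X (z + S • X) = starRingEnd ℂ S * ((‖X‖ ^ 2 : ℝ) : ℂ) := by
    intro S
    rw [herm_add_right, hXz, herm_smul_right, herm_self, zero_add]
  have hXx' : ∀ S : ℂ, herm (proj h X) (proj h (z + S • X)) =
      starRingEnd ℂ S * ((‖X‖ ^ 2 : ℝ) : ℂ) := fun S => by rw [herm_proj h hX, hXx]
  have hxX : ∀ S : ℂ, herm (z + S • X) X = S * ((‖X‖ ^ 2 : ℝ) : ℂ) := fun S => by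
    rw [← conj_herm, hXx]; simp
  have hxX' : ∀ S : ℂ, herm (proj h (z + S • X)) (proj h X) = S * ((‖X‖ ^ 2 : ℝ) : ℂ) := fun S => by
    rw [← conj_herm, hXx']; simp
  generalize hrdef : ‖X‖ ^ 2 = r at *
  generalize htdef : ‖proj h z‖ ^ 2 = t at *
  generalize hsdef : ‖z‖ ^ 2 = s at *
  have hsm : ∀ Y W, ContDiffAt ℝ 2 (fun x => gB h x Y W) z :=
    contDiffAt_gB h (htdef ▸ h0) (htdef ▸ h1) (hsdef ▸ hz)
  have hsm' {f : ℝ → ℝ} {a : ℝ} (hf : ContDiffAt ℝ ∞ f a) :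
      ContDiffAt ℝ ∞ (fun σ : ℝ => f (a + σ * r)) 0 := by
    have hl : ContDiffAt ℝ ∞ (fun σ : ℝ => a + σ * r) 0 := by fun_prop
    exact ContDiffAt.comp (g := f) 0 (by simpa using hf) hl
  have hder {f : ℝ → ℝ} {a f' : ℝ} (hf : HasDerivAt f f' a) :
      HasDerivAt (fun σ : ℝ => f (a + σ * r)) (f' * r) 0 := by
    have hl : HasDerivAt (fun σ : ℝ => a + σ * r) r 0 := by
      simpa using ((hasDerivAt_id (0 : ℝ)).mul_const r).const_add a
    exact HasDerivAt.comp (h₂ := f) 0 (by simpa using hf) hl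
  have sA := hsm' (contDiffAt_grauertCoeff h0 h1.ne)
  have sB := hsm' (contDiffAt_grauertCoeff' h0 h1.ne)
  have sC := hsm' (contDiffAt_bergmanCoeff N hz)
  have sD := hsm' (contDiffAt_bergmanCoeff' N hz)
  have hne : (∞ : WithTop ℕ∞) ≠ 0 := by simp
  -- This kills the quadratic part of the curvature, so the inverse matrix of the metric is never
  -- computed.
  have hH : ∀ q, dHol (fun x => ∑ i, X i * comps (gB h) x i q) X z = 0 := by
    intro q
    have e : (fun x => ∑ i, X i * comps (gB h) x i q) =
        fun x => gB h x X (EuclideanSpace.single q 1) := by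
      funext x
      exact sum_gB_left h x X _
    have hz0 : z + (0 : ℂ) • X = z := by simp
    have e2 := dHol_line (f := fun x => gB h x X (EuclideanSpace.single q 1)) (z := z) (e := X)
      (S := 0) (by rw [hz0]; exact (hsm _ _).differentiableAt two_ne_zero)
    rw [hz0] at e2
    rw [e, ← e2]
    have e3 := dHol_radial_conj (k₁ := fun σ => grauertCoeff (t + σ * r) + bergmanCoeff N (s + σ * r))
      (k₂ := fun σ => grauertCoeff' (t + σ * r)) (k₃ := fun σ => bergmanCoeff' N (s + σ * r))
      ((sA.add sC).differentiableAt hne) (sB.differentiableAt hne) (sD.differentiableAt hne)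
      (herm X (EuclideanSpace.single q 1)) (r * herm (proj h z) (proj h (EuclideanSpace.single q 1)))
      (r * herm X (EuclideanSpace.single q 1)) (r * herm z (EuclideanSpace.single q 1))
      (r * herm X (EuclideanSpace.single q 1))
    refine Eq.trans (congrArg (fun F => dHol F 1 0) ?_) e3
    funext S
    rw [gB_apply, hXx, hXx', hns, hnt, proj_add, proj_smul, herm_add_left, herm_add_left,
      herm_smul_left, herm_smul_left, herm_proj h hX]
    push_cast
    ring
  have hρ : ∀ S : ℂ, gB h (z + S • X) X X =
      (((grauertCoeff (t + ‖S‖ ^ 2 * r) + bergmanCoeff N (s + ‖S‖ ^ 2 * r)) * r +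
        (grauertCoeff' (t + ‖S‖ ^ 2 * r) + bergmanCoeff' N (s + ‖S‖ ^ 2 * r)) *
          (‖S‖ ^ 2 * r ^ 2) : ℝ) : ℂ) := by
    intro S
    have h2 : starRingEnd ℂ S * S = ((‖S‖ ^ 2 : ℝ) : ℂ) := by
      rw [mul_comm, Complex.mul_conj, Complex.normSq_eq_norm_sq]
    rw [gB_apply, hXx, hXx', hxX, hxX', hns, hnt, herm_proj h hX, herm_self, hrdef]
    push_cast at h2 ⊢
    linear_combination (((grauertCoeff' (t + ‖S‖ ^ 2 * r) : ℝ) : ℂ) +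
      ((bergmanCoeff' N (s + ‖S‖ ^ 2 * r) : ℝ) : ℂ)) * r ^ 2 * h2
  have hmain : dHol (fun y => dAnti (fun x =>
      ∑ i, X i * ∑ j, starRingEnd ℂ (X j) * comps (gB h) x i j) X y) X z =
      ((2 * (grauertCoeff' t + bergmanCoeff' N s) * r ^ 2 : ℝ) : ℂ) := by
    have e : (fun x => ∑ i, X i * ∑ j, starRingEnd ℂ (X j) * comps (gB h) x i j) =
        fun x => gB h x X X := by
      funext x
      rw [← sum_gB_left]
      simp only [← sum_gB_right h x _ X]
      rfl
    rw [e, dHol_dAnti_eq_line (hsm X X) X]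
    simp only [hρ]
    have hsmooth : ContDiffAt ℝ ∞ (fun σ : ℝ =>
        (grauertCoeff (t + σ * r) + bergmanCoeff N (s + σ * r)) * r +
        (grauertCoeff' (t + σ * r) + bergmanCoeff' N (s + σ * r)) * (σ * r ^ 2)) 0 :=
      ((sA.add sC).mul contDiffAt_const).add
        ((sB.add sD).mul (contDiffAt_id.mul contDiffAt_const))
    refine (dHol_dAnti_radial (ρ := fun σ : ℝ =>
        (grauertCoeff (t + σ * r) + bergmanCoeff N (s + σ * r)) * r +
        (grauertCoeff' (t + σ * r) + bergmanCoeff' N (s + σ * r)) * (σ * r ^ 2))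
      (hsmooth.of_le two_le_infty)).trans ?_
    rw [Complex.ofReal_inj]
    have dA := hder (hasDerivAt_grauertCoeff h0)
    have dC := hder (hasDerivAt_bergmanCoeff N hz)
    -- The derivative of φ'' + ψ'' is multiplied by σ = 0, so its value is irrelevant. The factor 2
    -- comes from differentiating φ' + ψ' once and the factor σ once.
    have dBD := ((sB.add sD).differentiableAt hne).hasDerivAt
    have := ((dA.add dC).mul_const r).add
      (dBD.mul ((hasDerivAt_id (0 : ℝ)).mul_const (r ^ 2)))
    refine this.deriv.trans ?_
    simp
    ring
  have hgz : gB h z X X = (((grauertCoeff t + bergmanCoeff N s) * r : ℝ) : ℂ) := by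
    simpa using hρ 0
  rw [holSecCurv, sum_curvTensor (fun i j => hsm _ _), hmain, hgz]
  simp only [hH, mul_zero, zero_mul, Finset.sum_const_zero, add_zero]
  rw [← Complex.ofReal_neg, Complex.ofReal_re, Complex.ofReal_re]
  have hpos : 0 < grauertCoeff t + bergmanCoeff N s := by
    have := one_le_grauertCoeff h0
    have := bergmanCoeff_pos N hz
    linarith
  field_simp
  ring

theorem exists_herm_eq_zero (hn : 2 ≤ n) (hnN : n ≤ N) (z : EuclideanSpace ℂ (Fin N)) :
    ∃ X : EuclideanSpace ℂ (Fin N), X ≠ 0 ∧ (∀ j : Fin N, n ≤ (j : ℕ) → X j = 0) ∧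
      herm X z = 0 := by
  let i : Fin N := ⟨0, by omega⟩
  let j : Fin N := ⟨1, by omega⟩
  have hij : i ≠ j := by simp [i, j]
  have hi (k : Fin N) (hk : n ≤ (k : ℕ)) : k ≠ i := by
    rintro rfl
    simp [i] at hk
    omega
  have hj (k : Fin N) (hk : n ≤ (k : ℕ)) : k ≠ j := by
    rintro rfl
    simp [j] at hk
    omega
  -- The witness conj(z_2) e_1 - conj(z_1) e_2 could vanish when z_1 = 0; then e_1 itself is
  -- orthogonal to z.
  by_cases hz : z i = 0
  · refine ⟨EuclideanSpace.single i 1, by simp, fun k hk => by simp [hi k hk], ?_⟩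
    rw [herm_apply]
    simp [hz]
  · refine ⟨starRingEnd ℂ (z j) • EuclideanSpace.single i 1 -
      starRingEnd ℂ (z i) • EuclideanSpace.single j 1, ?_, fun k hk => by
        simp [hi k hk, hj k hk], ?_⟩
    · intro h0
      have := congrArg (fun x : EuclideanSpace ℂ (Fin N) => x j) h0
      simp [hij.symm, hz] at this
    · rw [herm_apply]
      simp [sub_mul, Finset.sum_sub_distrib, ite_mul]
      ring

theorem tendsto_Kplus (hn : 2 ≤ n) {w : EuclideanSpace ℂ (Fin N)} (hw : w ∈ A h) :
    Tendsto (Kplus (gB h)) (𝓝[slice n w \ A h] w) (𝓝 ⊤) := by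
  have hw1 : ‖w‖ ^ 2 < 1 := by
    have : ‖w‖ < 1 := by simpa using hw.1
    nlinarith [norm_nonneg w]
  have hs : Tendsto (fun z : EuclideanSpace ℂ (Fin N) => ‖z‖ ^ 2) (𝓝[slice n w \ A h] w)
      (𝓝 (‖w‖ ^ 2)) :=
    ((continuous_norm.pow 2).tendsto w).mono_left nhdsWithin_le_nhds
  have hmem : ∀ᶠ z in 𝓝[slice n w \ A h] w, 0 < ‖proj h z‖ ^ 2 := by
    filter_upwards [self_mem_nhdsWithin] with z hz
    have : proj h z ≠ 0 := fun h0 => hz.2 ⟨hz.1.1, h0⟩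
    positivity
  have ht : Tendsto (fun z => ‖proj h z‖ ^ 2) (𝓝[slice n w \ A h] w) (𝓝[>] 0) := by
    refine tendsto_nhdsWithin_iff.2 ⟨?_, hmem⟩
    have : Continuous fun z => ‖proj h z‖ ^ 2 :=
      ((contDiff_proj (k := 0) h).continuous.norm).pow 2
    have h2 := this.tendsto w
    rw [hw.2] at h2
    simpa using h2.mono_left nhdsWithin_le_nhds
  have key := tendsto_tangential_curvature ht
    ((hasDerivAt_bergmanCoeff N hw1).continuousAt.tendsto.comp hs)
    ((contDiffAt_bergmanCoeff' N hw1).continuousAt.tendsto.comp hs)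
    ((hs.eventually_lt_const hw1).mono fun z hz => bergmanCoeff_pos N hz)
  rw [EReal.tendsto_nhds_top_iff_real]
  intro M
  filter_upwards [key.eventually_gt_atTop M, hmem, hs.eventually_lt_const hw1,
    (ht.mono_right nhdsWithin_le_nhds).eventually_lt_const one_pos] with z h1 h2 h3 h4
  obtain ⟨X, hX0, hX, hXz⟩ := exists_herm_eq_zero hn h z
  refine lt_of_lt_of_le (EReal.coe_lt_coe_iff.2 h1) ?_
  simp only [Function.comp]
  rw [← holSecCurv_tangential h h2 h4 h3 hX hX0 hXz]
  exact le_iSup₂ (f := fun (X : EuclideanSpace ℂ (Fin N)) (_ : X ≠ 0) =>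
    ((holSecCurv (gB h) z X : ℝ) : EReal)) X hX0

end Metric

/-! ### Leafwise curvature of the saddle foliation. -/

/-- The Gaussian curvature of the metric with density `∂∂̄ Φ(σ₀(Re T))`, where `Φ' = f`, at a
critical point of `σ₀`; here `σ₀' = 2 σ₁`, `σ₁' = 2 σ₂`, and so on. -/
theorem gaussCurv_of_critical {f g : ℝ → ℝ} {σ : ℕ → ℝ → ℝ}
    (hσ : ∀ k x, HasDerivAt (σ k) (2 * σ (k + 1) x) x)
    (hf : ∀ᶠ t in 𝓝 (σ 0 0), HasDerivAt f (g t) t) (hg : ContDiffAt ℝ 2 g (σ 0 0))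
    (h1 : σ 1 0 = 0) (hne : f (σ 0 0) * σ 2 0 ≠ 0) :
    gaussCurv (fun T => f (σ 0 T.re) * σ 2 T.re + g (σ 0 T.re) * σ 1 T.re ^ 2) 0 =
      -(1 / 2) / (f (σ 0 0) * σ 2 0) *
        ((12 * g (σ 0 0) * σ 2 0 ^ 2 + 4 * f (σ 0 0) * σ 4 0) / (f (σ 0 0) * σ 2 0) -
          (2 * f (σ 0 0) * σ 3 0 / (f (σ 0 0) * σ 2 0)) ^ 2) := by
  have ht : Tendsto (σ 0) (𝓝 0) (𝓝 (σ 0 0)) := (hσ 0 0).continuousAt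
  have hgd : ∀ᶠ t in 𝓝 (σ 0 0), HasDerivAt g (deriv g t) t :=
    (hg.eventually (by simp)).mono fun t h => (h.differentiableAt two_ne_zero).hasDerivAt
  have hgdd : HasDerivAt (deriv g) (deriv (deriv g) (σ 0 0)) (σ 0 0) := by
    have h3 : DifferentiableAt ℝ (fderiv ℝ g) (σ 0 0) :=
      (hg.fderiv_right (m := 1) (by norm_num [one_add_one_eq_two])).differentiableAt one_ne_zero
    have h4 : DifferentiableAt ℝ (deriv g) (σ 0 0) := h3.clm_apply (differentiableAt_const (1 : ℝ))
    exact h4.hasDerivAt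
  -- Every term carrying a derivative of g also carries a positive power of σ₁; in the second
  -- derivative at the critical point these still vanish, leaving only f and g.
  have hη : ∀ᶠ x in 𝓝 0, HasDerivAt (fun x => f (σ 0 x) * σ 2 x + g (σ 0 x) * σ 1 x ^ 2)
      (6 * g (σ 0 x) * (σ 1 x * σ 2 x) + 2 * f (σ 0 x) * σ 3 x +
        2 * deriv g (σ 0 x) * σ 1 x ^ 3) x := by
    filter_upwards [ht.eventually hf, ht.eventually hgd] with x hfx hgx
    have e1 := HasDerivAt.comp x hfx (hσ 0 x)
    have e2 := HasDerivAt.comp x hgx (hσ 0 x)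
    refine ((e1.mul (hσ 2 x)).add (e2.mul ((hσ 1 x).pow 2))).congr_deriv ?_
    simp only [Function.comp, Pi.pow_apply]
    push_cast
    ring
  have hη' : HasDerivAt (fun x => 6 * g (σ 0 x) * (σ 1 x * σ 2 x) + 2 * f (σ 0 x) * σ 3 x +
        2 * deriv g (σ 0 x) * σ 1 x ^ 3)
      (12 * g (σ 0 0) * σ 2 0 ^ 2 + 4 * f (σ 0 0) * σ 4 0) 0 := by
    have e1 := HasDerivAt.comp 0 hf.self_of_nhds (hσ 0 0)
    have e2 := HasDerivAt.comp 0 hgd.self_of_nhds (hσ 0 0)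
    have e3 := HasDerivAt.comp 0 hgdd (hσ 0 0)
    refine ((((e2.const_mul 6).mul ((hσ 1 0).mul (hσ 2 0))).add
      ((e1.const_mul 2).mul (hσ 3 0))).add ((e3.const_mul 2).mul ((hσ 1 0).pow 3))).congr_deriv ?_
    simp only [Function.comp, Pi.mul_apply, Pi.pow_apply, h1]
    ring
  rw [gaussCurv_comp_re hη hη' (by simpa [h1] using hne)]
  simp [h1]

section Saddle

variable {n : ℕ}

/-- The sums `∑ m_i c_i^k exp(2 c_i x)`. -/
def expSum (c m : Fin n → ℝ) (k : ℕ) (x : ℝ) : ℝ := ∑ i, m i * c i ^ k * Real.exp (2 * c i * x)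

theorem hasDerivAt_expSum (c m : Fin n → ℝ) (k : ℕ) (x : ℝ) :
    HasDerivAt (expSum c m k) (2 * expSum c m (k + 1) x) x := by
  have h : ∀ i ∈ Finset.univ, HasDerivAt (fun x => m i * c i ^ k * Real.exp (2 * c i * x))
      (2 * (m i * c i ^ (k + 1) * Real.exp (2 * c i * x))) x := by
    intro i _
    refine ((((hasDerivAt_id x).const_mul (2 * c i)).exp).const_mul (m i * c i ^ k)).congr_deriv ?_
    simp only [id]
    ring
  exact (HasDerivAt.fun_sum h).congr_deriv (by simp only [expSum, Finset.mul_sum])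

/-- The nonzero coefficients of the saddle field. -/
def saddleExponent (n : ℕ) (α : ℝ) (i : Fin n) : ℝ := if (i : ℕ) + 1 < n then 1 else α

theorem expSum_saddleExponent_add_two (α : ℝ) (m : Fin n → ℝ) (k : ℕ) (x : ℝ) :
    expSum (saddleExponent n α) m (k + 2) x =
      (1 + α) * expSum (saddleExponent n α) m (k + 1) x - α * expSum (saddleExponent n α) m k x := by
  simp only [expSum, Finset.mul_sum, ← Finset.sum_sub_distrib]
  refine Finset.sum_congr rfl fun i _ => ?_
  -- Both exponents 1 and α are roots of c² = (1 + α) c - α.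
  have h : saddleExponent n α i ^ 2 = (1 + α) * saddleExponent n α i - α := by
    simp only [saddleExponent]
    split_ifs <;> ring
  rw [pow_add, h]
  ring

variable {N : ℕ} (h : n ≤ N)

theorem saddleCoeff_castLE (α : ℝ) (i : Fin n) :
    saddleCoeff n α (Fin.castLE h i) = (saddleExponent n α i : ℂ) := by
  have : ¬ (i : ℕ) + 1 < n → (i : ℕ) + 1 = n := by omega
  by_cases hi : (i : ℕ) + 1 < n
  · simp [saddleCoeff, saddleExponent, hi]
  · simp [saddleCoeff, saddleExponent, this hi]

theorem saddleCoeff_eq_zero (α : ℝ) {j : Fin N} (hj : n ≤ (j : ℕ)) : saddleCoeff n α j = 0 := by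
  simp [saddleCoeff, show ¬ (j : ℕ) + 1 < n by omega, show ¬ (j : ℕ) + 1 = n by omega]

theorem saddleField_apply_eq_zero (α : ℝ) (z : EuclideanSpace ℂ (Fin N)) (j : Fin N)
    (hj : n ≤ (j : ℕ)) : saddleField n α z j = 0 := by
  simp [saddleField, saddleCoeff_eq_zero α hj]

theorem exp_mul_conj (c : ℝ) (T ζ : ℂ) :
    Complex.exp (c * T) * ζ * starRingEnd ℂ (Complex.exp (c * T) * ζ) =
      ((‖ζ‖ ^ 2 * Real.exp (2 * c * T.re) : ℝ) : ℂ) := by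
  rw [Complex.mul_conj, Complex.normSq_eq_norm_sq, norm_mul, Complex.norm_exp, Complex.ofReal_inj,
    mul_pow, ← Real.exp_nat_mul, Complex.re_ofReal_mul, mul_comm (‖ζ‖ ^ 2)]
  push_cast
  ring_nf

theorem proj_saddleFlow_apply (α : ℝ) (z : EuclideanSpace ℂ (Fin N)) (T : ℂ) (i : Fin n) :
    proj h (saddleFlow n α z T) i = Complex.exp (saddleExponent n α i * T) * proj h z i := by
  simp [proj, saddleFlow, saddleCoeff_castLE]

theorem proj_saddleField_apply (α : ℝ) (z : EuclideanSpace ℂ (Fin N)) (i : Fin n) :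
    proj h (saddleField n α z) i = saddleExponent n α i * proj h z i := by
  simp [proj, saddleField, saddleCoeff_castLE]

theorem norm_proj_saddleFlow (α : ℝ) (z : EuclideanSpace ℂ (Fin N)) (T : ℂ) :
    ‖proj h (saddleFlow n α z T)‖ ^ 2 =
      expSum (saddleExponent n α) (fun i => ‖proj h z i‖ ^ 2) 0 T.re := by
  rw [← Complex.ofReal_inj, ← herm_self, herm_apply, expSum, Complex.ofReal_sum]
  refine Finset.sum_congr rfl fun i _ => ?_
  rw [proj_saddleFlow_apply, exp_mul_conj, pow_zero, mul_one]

theorem herm_saddleField_self (α : ℝ) (z : EuclideanSpace ℂ (Fin N)) (T : ℂ) :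
    herm (saddleField n α (saddleFlow n α z T)) (saddleFlow n α z T) =
      (expSum (saddleExponent n α) (fun i => ‖proj h z i‖ ^ 2) 1 T.re : ℂ) := by
  rw [← herm_proj h (saddleField_apply_eq_zero α _), herm_apply, expSum, Complex.ofReal_sum]
  refine Finset.sum_congr rfl fun i _ => ?_
  rw [proj_saddleField_apply, mul_assoc, proj_saddleFlow_apply, exp_mul_conj]
  push_cast
  ring

theorem herm_saddleField_saddleField (α : ℝ) (z : EuclideanSpace ℂ (Fin N)) (T : ℂ) :
    herm (saddleField n α (saddleFlow n α z T)) (saddleField n α (saddleFlow n α z T)) =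
      (expSum (saddleExponent n α) (fun i => ‖proj h z i‖ ^ 2) 2 T.re : ℂ) := by
  rw [← herm_proj h (saddleField_apply_eq_zero α _), herm_apply, expSum, Complex.ofReal_sum]
  refine Finset.sum_congr rfl fun i _ => ?_
  rw [proj_saddleField_apply, map_mul, Complex.conj_ofReal, mul_mul_mul_comm,
    proj_saddleFlow_apply, exp_mul_conj]
  push_cast
  ring

/-- The flow fixes the last N - n coordinates, so the leaf keeps the contribution |w|² constant. -/
theorem norm_saddleFlow (α : ℝ) {z w : EuclideanSpace ℂ (Fin N)} (hw : proj h w = 0)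
    (hz : ∀ j : Fin N, n ≤ (j : ℕ) → z j = w j) (T : ℂ) :
    ‖saddleFlow n α z T‖ ^ 2 =
      expSum (saddleExponent n α) (fun i => ‖proj h z i‖ ^ 2) 0 T.re + ‖w‖ ^ 2 := by
  rw [← norm_proj_saddleFlow]
  refine norm_proj_add_slice h hw fun j hj => ?_
  simp [saddleFlow, saddleCoeff_eq_zero α hj, hz j hj]

theorem pullback_saddleFlow (α : ℝ) {z w : EuclideanSpace ℂ (Fin N)} (hw : proj h w = 0)
    (hz : ∀ j : Fin N, n ≤ (j : ℕ) → z j = w j) (T : ℂ) {σ : ℕ → ℝ → ℝ}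
    (hσ : σ = expSum (saddleExponent n α) (fun i => ‖proj h z i‖ ^ 2)) :
    pullback (gB h) (saddleFlow n α z) T =
      (grauertCoeff (σ 0 T.re) + bergmanCoeff N (σ 0 T.re + ‖w‖ ^ 2)) * σ 2 T.re +
      (grauertCoeff' (σ 0 T.re) + bergmanCoeff' N (σ 0 T.re + ‖w‖ ^ 2)) * σ 1 T.re ^ 2 := by
  have hX := saddleField_apply_eq_zero (n := n) α (saddleFlow n α z T)
  have h1 := herm_saddleField_self h α z T
  have h1' : herm (saddleFlow n α z T) (saddleField n α (saddleFlow n α z T)) =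
      (expSum (saddleExponent n α) (fun i => ‖proj h z i‖ ^ 2) 1 T.re : ℂ) := by
    rw [← conj_herm, h1, Complex.conj_ofReal]
  have h2 : herm (proj h (saddleFlow n α z T)) (proj h (saddleField n α (saddleFlow n α z T))) =
      (expSum (saddleExponent n α) (fun i => ‖proj h z i‖ ^ 2) 1 T.re : ℂ) := by
    rw [← conj_herm, herm_proj h hX, h1, Complex.conj_ofReal]
  rw [pullback, (hasDerivAt_saddleFlow n α z T).deriv, gB_apply, herm_proj h hX, herm_proj h hX,
    h1, h1', h2, herm_saddleField_saddleField h, norm_proj_saddleFlow, norm_saddleFlow h α hw hz,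
    ← hσ, ← Complex.ofReal_re ((grauertCoeff (σ 0 T.re) + bergmanCoeff N (σ 0 T.re + ‖w‖ ^ 2)) *
      σ 2 T.re + (grauertCoeff' (σ 0 T.re) + bergmanCoeff' N (σ 0 T.re + ‖w‖ ^ 2)) *
      σ 1 T.re ^ 2)]
  congr 1
  push_cast
  ring

theorem leafCurv_of_mem_orthoLocus {α : ℝ} (hα : α < 0) {z w : EuclideanSpace ℂ (Fin N)}
    (hw : proj h w = 0) (hz : z ∈ orthoLocus h α w) :
    leafCurv h α z =
      -6 * (grauertCoeff' (‖proj h z‖ ^ 2) + bergmanCoeff' N (‖z‖ ^ 2)) /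
        (grauertCoeff (‖proj h z‖ ^ 2) + bergmanCoeff N (‖z‖ ^ 2)) ^ 2 -
      2 / ((grauertCoeff (‖proj h z‖ ^ 2) + bergmanCoeff N (‖z‖ ^ 2)) * ‖proj h z‖ ^ 2) := by
  obtain ⟨⟨⟨hball, hslice⟩, hzA⟩, horth⟩ := hz
  have hp : proj h z ≠ 0 := fun h0 => hzA ⟨hball, h0⟩
  have hz1 : ‖z‖ ^ 2 < 1 := by
    have : ‖z‖ < 1 := by simpa using hball
    nlinarith [norm_nonneg z]
  have hs := norm_proj_add_slice h hw hslice
  have h0 : 0 < ‖proj h z‖ ^ 2 := by positivity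
  have h1 : ‖proj h z‖ ^ 2 < 1 := by nlinarith [sq_nonneg ‖w‖]
  obtain ⟨σ, hσ⟩ : ∃ σ, σ = expSum (saddleExponent n α) (fun i => ‖proj h z i‖ ^ 2) := ⟨_, rfl⟩
  have hσ0 : σ 0 0 = ‖proj h z‖ ^ 2 := by
    have := norm_proj_saddleFlow h α z 0
    rw [saddleFlow_zero, ← hσ, Complex.zero_re] at this
    exact this.symm
  have hσ1 : σ 1 0 = 0 := by
    have := herm_saddleField_self h α z 0
    rw [saddleFlow_zero, ← conj_herm, horth, map_zero, ← hσ, Complex.zero_re] at this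
    exact_mod_cast this.symm
  have hrec (k : ℕ) : σ (k + 2) 0 = (1 + α) * σ (k + 1) 0 - α * σ k 0 := by
    rw [hσ]
    exact expSum_saddleExponent_add_two α _ k 0
  have hσ2 := hrec 0
  have hσ3 := hrec 1
  have hσ4 := hrec 2
  simp only [zero_add, Nat.reduceAdd] at hσ2 hσ3 hσ4
  have hpos : 0 < grauertCoeff (‖proj h z‖ ^ 2) + bergmanCoeff N (‖z‖ ^ 2) := by
    have := one_le_grauertCoeff h0
    have := bergmanCoeff_pos N hz1
    linarith
  have hcurv := gaussCurv_of_critical (σ := σ)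
    (f := fun t => grauertCoeff t + bergmanCoeff N (t + ‖w‖ ^ 2))
    (g := fun t => grauertCoeff' t + bergmanCoeff' N (t + ‖w‖ ^ 2))
    (fun k x => hσ ▸ hasDerivAt_expSum _ _ k x)
    (by
      rw [hσ0]
      filter_upwards [lt_mem_nhds h0, gt_mem_nhds (show ‖proj h z‖ ^ 2 < 1 - ‖w‖ ^ 2 by linarith)]
        with t ht ht'
      exact (hasDerivAt_grauertCoeff ht).add
        ((hasDerivAt_bergmanCoeff N (by linarith)).comp_add_const t (‖w‖ ^ 2)))
    (by
      rw [hσ0]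
      have e1 : ContDiffAt ℝ ∞ (fun t => t + ‖w‖ ^ 2) (‖proj h z‖ ^ 2) := by fun_prop
      have e2 : ContDiffAt ℝ ∞ (fun t => bergmanCoeff' N (t + ‖w‖ ^ 2)) (‖proj h z‖ ^ 2) :=
        ContDiffAt.comp (g := bergmanCoeff' N) _ (contDiffAt_bergmanCoeff' N (by linarith)) e1
      exact ((contDiffAt_grauertCoeff' h0 h1.ne).add e2).of_le two_le_infty)
    hσ1
    (by
      -- Since σ₁(0) = 0, the recursion gives σ₂(0) = -α t, nonzero because α ≠ 0 and t > 0.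
      rw [hσ2, hσ1, hσ0, ← hs]
      refine mul_ne_zero hpos.ne' ?_
      have : α * ‖proj h z‖ ^ 2 ≠ 0 := mul_ne_zero hα.ne h0.ne'
      simpa using this)
  rw [leafCurv]
  refine (congrArg (fun F => gaussCurv F 0) (funext fun T =>
    pullback_saddleFlow h α hw hslice T hσ)).trans (hcurv.trans ?_)
  -- Here σ₃ = (1 + α) σ₂ and σ₄ = ((1 + α)² - α) σ₂, so the squares (1 + α)² cancel and the
  -- remaining α cancels against σ₂ = -α t.
  rw [hσ4, hσ3, hσ2, hσ1, hσ0, ← hs]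
  generalize grauertCoeff (‖proj h z‖ ^ 2) + bergmanCoeff N (‖z‖ ^ 2) = a at *
  generalize grauertCoeff' (‖proj h z‖ ^ 2) + bergmanCoeff' N (‖z‖ ^ 2) = b at *
  generalize ‖proj h z‖ ^ 2 = t at *
  have ha := hpos.ne'
  have ht := h0.ne'
  have hα' := hα.ne
  rw [mul_zero, zero_sub, mul_zero, sub_zero]
  field_simp
  ring

theorem tendsto_leafCurv {α : ℝ} (hα : α < 0) {w : EuclideanSpace ℂ (Fin N)} (hw : w ∈ A h) :
    Tendsto (leafCurv h α) (comap (fun z => ‖z‖) (𝓝 1) ⊓ 𝓟 (orthoLocus h α w))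
      (𝓝 (-6 / ((N : ℝ) + 1))) := by
  have hw1 : 0 < 1 - ‖w‖ ^ 2 := by
    have : ‖w‖ < 1 := by simpa using hw.1
    nlinarith [norm_nonneg w]
  generalize hl : comap (fun z => ‖z‖) (𝓝 1) ⊓ 𝓟 (orthoLocus h α w) = l
  have hnorm : Tendsto (fun z : EuclideanSpace ℂ (Fin N) => ‖z‖) l (𝓝 1) :=
    tendsto_comap.mono_left (hl ▸ inf_le_left)
  have hmem : ∀ᶠ z in l, z ∈ orthoLocus h α w := by
    rw [← hl]
    exact mem_inf_of_right (mem_principal_self _)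
  have hs : Tendsto (fun z : EuclideanSpace ℂ (Fin N) => ‖z‖ ^ 2) l (𝓝 1) := by
    simpa using hnorm.pow 2
  have hy : Tendsto (fun z : EuclideanSpace ℂ (Fin N) => 1 - ‖z‖ ^ 2) l (𝓝 0) := by
    simpa using hs.const_sub 1
  have ht : Tendsto (fun z => ‖proj h z‖ ^ 2) l (𝓝 (1 - ‖w‖ ^ 2)) := by
    refine (hs.sub_const (‖w‖ ^ 2)).congr' ?_
    filter_upwards [hmem] with z hz
    rw [norm_proj_add_slice h hw.2 hz.1.1.2]
    ring
  have ha := (continuousAt_grauertCoeff hw1).tendsto.comp ht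
  have hb := (continuousAt_grauertCoeff' hw1).tendsto.comp ht
  have hN : (N : ℝ) + 1 ≠ 0 := by positivity
  -- With y = 1 - |z|², multiplying φ' + ψ' by y and φ'' + ψ'' by y² removes the poles of the
  -- Bergman terms and leaves expressions with finite limits.
  have hden := (ha.mul hy).add_const ((N : ℝ) + 1)
  have hnum := (hb.mul (hy.pow 2)).add_const ((N : ℝ) + 1)
  have hlim := ((hnum.const_mul (-6)).div (hden.pow 2) (by simpa using hN)).sub
    ((hy.const_mul 2).div (hden.mul ht) (by simpa using ⟨hN, hw1.ne'⟩))
  have hval : -6 * (grauertCoeff' (1 - ‖w‖ ^ 2) * 0 ^ 2 + ((N : ℝ) + 1)) /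
      (grauertCoeff (1 - ‖w‖ ^ 2) * 0 + ((N : ℝ) + 1)) ^ 2 -
      2 * 0 / ((grauertCoeff (1 - ‖w‖ ^ 2) * 0 + ((N : ℝ) + 1)) * (1 - ‖w‖ ^ 2)) =
      -6 / ((N : ℝ) + 1) := by
    field_simp
    ring
  rw [hval] at hlim
  refine hlim.congr' ?_
  filter_upwards [hmem] with z hz
  rw [leafCurv_of_mem_orthoLocus h hα hw.2 hz]
  have hz1 : 0 < 1 - ‖z‖ ^ 2 := by
    have : ‖z‖ < 1 := by simpa using hz.1.1.1
    nlinarith [norm_nonneg z]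
  have hp : proj h z ≠ 0 := fun h0 => hz.1.2 ⟨hz.1.1.1, h0⟩
  have h0 : 0 < ‖proj h z‖ ^ 2 := by positivity
  have h1 := one_le_grauertCoeff h0
  simp only [Function.comp, Pi.div_apply, bergmanCoeff, bergmanCoeff']
  generalize grauertCoeff (‖proj h z‖ ^ 2) = a at *
  generalize grauertCoeff' (‖proj h z‖ ^ 2) = b at *
  generalize 1 - ‖z‖ ^ 2 = y at *
  generalize ‖proj h z‖ ^ 2 = t at *
  have hd : a * y + ((N : ℝ) + 1) ≠ 0 := by positivity
  have e1 : a + ((N : ℝ) + 1) / y = (a * y + ((N : ℝ) + 1)) / y := by field_simp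
  rw [e1]
  field_simp

end Saddle

end Grauert

end

theorem theorem1p2 (n N : ℕ) (hn : 2 ≤ n) (hnN : n ≤ N)
    (w : EuclideanSpace ℂ (Fin N)) (hw : w ∈ Grauert.A hnN) :
    Tendsto (Grauert.Kplus (Grauert.gB hnN)) (𝓝[Grauert.slice n w \ Grauert.A hnN] w) (𝓝 ⊤) ∧
    ∀ α : ℝ, α < 0 →
      Tendsto (Grauert.leafCurv hnN α)
        (comap (fun z => ‖z‖) (𝓝 1) ⊓ 𝓟 (Grauert.orthoLocus hnN α w))
        (𝓝 (-6 / ((N : ℝ) + 1))) := by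
  exact ⟨Grauert.tendsto_Kplus hnN hn hw, fun α hα => Grauert.tendsto_leafCurv hnN hα hw⟩
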